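/- For an integer $n\ge 1$ and any integer $k$ (possibly negative) let $$T_n(k)=\sum_{i\text{ odd}}\binom ni i^k .$$ Let $\nu(z)$ denote the exponent of $2$ in a 2-adic number $z$, with $\nu(0)=\infty$, and let $\alpha(m)$ denote the number of 1's in the binary expansion of a nonnegative integer $m$. Suppose $e\ge 2$, $0\le t\le e-1$ and $2^e+2^t\le n<2^e+2^{t+1}$. Let $$S_n=\Big\{p\in\mathbb Z:\ \max(0,\,n-2^e-2^{e-1})\le p<2^{e-1}\ \text{ and }\ \binom{n-1-p}{p}\equiv 1\pmod 2\Big\}.$$ For $p\in S_n$, say that an integer $q<2^{e-1}$ is associated to $p$ if $q=p$, or $q=p+2^w$ for some integer $w\ge 0$ with $w=\nu(n)-1$ or $w>t$. If $q$ is associated to an integer $p$ of $S_n$, then there exists a 2-adic integer $x_0$ such that for all integers $x$ $$\nu\big(T_n(2^{e-1}x+q)\big)=\nu(x-x_0)+n-2-\alpha(p_0),$$ where $p_0$ is the residue of $p$ modulo $2^t$. -/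

import Mathlib

namespace PartialStirling

/-- The partial Stirling number `T_n(k)`, the sum of `binom(n,i) * i^k` over the odd `i`, for an
arbitrary integer exponent `k`. For negative `k` it is a rational number with odd denominator. -/
def T (n : ℕ) (k : ℤ) : ℚ :=
  ∑ i ∈ (Finset.range (n + 1)).filter Odd, (n.choose i : ℚ) * (i : ℚ) ^ k

/-- The exponent of `2` in a 2-adic number; it is `⊤` (that is, infinity) exactly at `0`. -/
noncomputable def nu (z : ℚ_[2]) : WithTop ℤ :=
  Padic.addValuation z

/-- `alpha m` is the number of 1's in the binary expansion of `m`. -/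
def alpha (m : ℕ) : ℕ :=
  (Nat.digits 2 m).count 1

/-- The set `S_n`, where `2^e` is the largest power of `2` that is at most `n`. -/
def S (e n : ℕ) : Set ℕ :=
  {p | max (0 : ℤ) ((n : ℤ) - 2 ^ e - 2 ^ (e - 1)) ≤ (p : ℤ) ∧ p < 2 ^ (e - 1) ∧
    Odd ((n - 1 - p).choose p)}

/-- `q < 2^(e-1)` is associated to `p`: either `q = p`, or `q = p + 2^w` where `w` is the exponent
of `2` in `n` minus one, or `w > t`. -/
def Associated (e t n q p : ℕ) : Prop :=
  q < 2 ^ (e - 1) ∧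
    (q = p ∨ ∃ w : ℕ, (w + 1 = padicValNat 2 n ∨ t < w) ∧ q = p + 2 ^ w)

end PartialStirling

namespace PartialStirling

/-! ### Binary digit sums and binomial coefficients -/

theorem alpha_eq_sum (m : ℕ) : alpha m = (Nat.digits 2 m).sum := by
  unfold alpha
  have h : ∀ l : List ℕ, (∀ x ∈ l, x < 2) → l.count 1 = l.sum := by
    intro l
    induction l with
    | nil => simp
    | cons a l ih =>
      intro hl
      have ha : a < 2 := hl a (by simp)
      have := ih (fun x hx => hl x (by simp [hx]))
      interval_cases a <;> simp [this, add_comm]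
  exact h _ (fun x hx => Nat.digits_lt_base (by norm_num) hx)

@[simp] theorem alpha_zero : alpha 0 = 0 := by simp [alpha]

@[simp] theorem alpha_one : alpha 1 = 1 := by simp [alpha]

theorem alpha_double (m : ℕ) : alpha (2 * m) = alpha m := by
  rcases Nat.eq_zero_or_pos m with rfl | h
  · simp
  · simp [alpha_eq_sum, Nat.digits_def' (b := 2) (by norm_num) (show 0 < 2 * m by omega)]

theorem alpha_double_add_one (m : ℕ) : alpha (2 * m + 1) = alpha m + 1 := by
  rw [alpha_eq_sum, alpha_eq_sum, Nat.digits_def' (b := 2) (by norm_num) (by omega)]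
  have h1 : (2 * m + 1) % 2 = 1 := by omega
  have h2 : (2 * m + 1) / 2 = m := by omega
  rw [h1, h2, List.sum_cons, add_comm]

theorem alpha_two_pow_mul (t m : ℕ) : alpha (2 ^ t * m) = alpha m := by
  induction t with
  | zero => simp
  | succ t ih => rw [pow_succ', mul_assoc, alpha_double, ih]

theorem alpha_two_pow (t : ℕ) : alpha (2 ^ t) = 1 := by
  simpa using alpha_two_pow_mul t 1

theorem alpha_two_pow_mul_add (t z : ℕ) {r : ℕ} (hr : r < 2 ^ t) :
    alpha (2 ^ t * z + r) = alpha z + alpha r := by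
  induction t generalizing r with
  | zero =>
    have : r = 0 := by simpa using hr
    simp [this]
  | succ t ih =>
    rw [pow_succ] at hr
    rcases Nat.even_or_odd' r with ⟨s, rfl | rfl⟩
    · have : 2 ^ (t + 1) * z + 2 * s = 2 * (2 ^ t * z + s) := by ring
      rw [this, alpha_double, alpha_double, ih (by omega)]
    · have : 2 ^ (t + 1) * z + (2 * s + 1) = 2 * (2 ^ t * z + s) + 1 := by ring
      rw [this, alpha_double_add_one, alpha_double_add_one, ih (by omega), add_assoc]

theorem alpha_div_add_mod (t r : ℕ) : alpha (r / 2 ^ t) + alpha (r % 2 ^ t) = alpha r := by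
  conv_rhs => rw [← Nat.div_add_mod r (2 ^ t)]
  rw [alpha_two_pow_mul_add t _ (Nat.mod_lt _ (by positivity))]

theorem alpha_succ_le (m : ℕ) : alpha (m + 1) ≤ alpha m + 1 := by
  induction m using Nat.strong_induction_on with
  | _ m ih =>
    rcases Nat.even_or_odd' m with ⟨k, rfl | rfl⟩
    · rw [alpha_double_add_one, alpha_double]
    · have e : 2 * k + 1 + 1 = 2 * (k + 1) := by ring
      rw [e, alpha_double, alpha_double_add_one]
      have := ih k (by omega)
      omega

theorem alpha_add_le (a b : ℕ) : alpha (a + b) ≤ alpha a + alpha b := by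
  induction a using Nat.strong_induction_on generalizing b with
  | _ a ih =>
    rcases Nat.eq_zero_or_pos a with rfl | ha
    · simp
    rcases Nat.even_or_odd' a with ⟨c, rfl | rfl⟩ <;>
    rcases Nat.even_or_odd' b with ⟨d, rfl | rfl⟩ <;>
    have h1 := ih c (by omega) d
    · rw [← mul_add, alpha_double, alpha_double, alpha_double]; exact h1
    · rw [← add_assoc, ← mul_add, alpha_double_add_one, alpha_double_add_one, alpha_double]
      omega
    · rw [add_right_comm, ← mul_add, alpha_double_add_one, alpha_double_add_one, alpha_double]
      omega
    · have h3 := alpha_succ_le (c + d)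
      have e : 2 * c + 1 + (2 * d + 1) = 2 * (c + d + 1) := by ring
      rw [e, alpha_double, alpha_double_add_one, alpha_double_add_one]
      omega

theorem padicValNat_choose_add_alpha (a b : ℕ) :
    padicValNat 2 ((a + b).choose a) + alpha (a + b) = alpha a + alpha b := by
  have h := @sub_one_mul_padicValNat_choose_eq_sub_sum_digits' 2 a b ⟨Nat.prime_two⟩
  have h2 := alpha_add_le a b
  rw [add_comm b a] at h
  simp only [alpha_eq_sum] at *
  omega

theorem alpha_mod_le (t r : ℕ) : alpha (r % 2 ^ t) ≤ alpha r := by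
  have := alpha_div_add_mod t r; omega

/-- The number of binary digits 1 of `r` in the positions `≥ t`. -/
def highAlpha (t r : ℕ) : ℕ := alpha (r / 2 ^ t)

theorem highAlpha_of_lt {t r : ℕ} (h : r < 2 ^ t) : highAlpha t r = 0 := by
  simp [highAlpha, Nat.div_eq_of_lt h]

theorem alpha_pos {m : ℕ} (h : 0 < m) : 0 < alpha m := by
  induction m using Nat.strong_induction_on with
  | _ m ih =>
    rcases Nat.even_or_odd' m with ⟨k, rfl | rfl⟩
    · rw [alpha_double]; exact ih k (by omega) (by omega)
    · rw [alpha_double_add_one]; omega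

theorem highAlpha_pos {t r : ℕ} (h : 2 ^ t ≤ r) : 0 < highAlpha t r :=
  alpha_pos (Nat.div_pos h (by positivity))

theorem highAlpha_add_le_add (t r d : ℕ) : highAlpha t (r + d) ≤ highAlpha t r + d := by
  induction d with
  | zero => simp
  | succ d ih =>
    have : highAlpha t (r + d + 1) ≤ highAlpha t (r + d) + 1 := by
      unfold highAlpha
      rw [Nat.succ_div]
      split_ifs
      · exact (alpha_add_le _ _).trans (by simp)
      · simp
    rw [← add_assoc]; omega

theorem highAlpha_add_le (t r s : ℕ) :
    highAlpha t r + highAlpha t s ≤ highAlpha t (r + s) + padicValNat 2 ((r + s).choose r) := by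
  have h := padicValNat_choose_add_alpha r s
  have h1 := alpha_div_add_mod t r
  have h2 := alpha_div_add_mod t s
  have h3 := alpha_div_add_mod t (r + s)
  have h4 : alpha ((r + s) % 2 ^ t) ≤ alpha (r % 2 ^ t) + alpha (s % 2 ^ t) := by
    rw [Nat.add_mod]
    exact (alpha_mod_le _ _).trans (alpha_add_le _ _)
  unfold highAlpha
  omega

theorem two_pow_dvd_of_le_padicValNat {k m : ℕ} (h : k ≤ padicValNat 2 m) : 2 ^ k ∣ m :=
  (pow_dvd_pow 2 h).trans pow_padicValNat_dvd

theorem two_pow_highAlpha_dvd (t r s : ℕ) :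
    2 ^ (highAlpha t r + highAlpha t s) ∣ 2 ^ highAlpha t (r + s) * (r + s).choose r :=
  (pow_dvd_pow 2 (highAlpha_add_le t r s)).trans <| by
    rw [pow_add]; exact mul_dvd_mul_left _ pow_padicValNat_dvd

theorem odd_choose_iff_padicValNat {a b : ℕ} :
    Odd ((a + b).choose a) ↔ padicValNat 2 ((a + b).choose a) = 0 := by
  have : (a + b).choose a ≠ 0 := (Nat.choose_pos (Nat.le_add_right _ _)).ne'
  rw [padicValNat.eq_zero_iff, ← Nat.not_even_iff_odd, even_iff_two_dvd]
  simp [this]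

theorem odd_choose_add_two_pow {a i : ℕ} (h : a < 2 ^ i) : Odd ((a + 2 ^ i).choose a) := by
  rw [odd_choose_iff_padicValNat]
  have h1 := padicValNat_choose_add_alpha a (2 ^ i)
  have h2 := alpha_two_pow_mul_add i 1 h
  rw [mul_one, add_comm] at h2
  rw [alpha_one] at h2
  rw [alpha_two_pow] at h1
  omega

theorem choose_two_pow_succ (i : ℕ) :
    ∃ u : ℕ, Odd u ∧ (2 ^ i + 2 ^ i).choose (2 ^ i) = 2 * u := by
  have h1 := padicValNat_choose_add_alpha (2 ^ i) (2 ^ i)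
  have h2 := alpha_two_pow (i + 1)
  rw [pow_succ, mul_two] at h2
  rw [h2, alpha_two_pow] at h1
  have hv : padicValNat 2 ((2 ^ i + 2 ^ i).choose (2 ^ i)) = 1 := by omega
  have hd : 2 ∣ (2 ^ i + 2 ^ i).choose (2 ^ i) := by
    have := two_pow_dvd_of_le_padicValNat hv.ge
    simpa using this
  obtain ⟨u, hu⟩ := hd
  refine ⟨u, ?_, hu⟩
  by_contra hc
  rw [Nat.not_odd_iff_even] at hc
  obtain ⟨v, hv'⟩ := hc
  have hu0 : (2 ^ i + 2 ^ i).choose (2 ^ i) ≠ 0 := (Nat.choose_pos (Nat.le_add_right _ _)).ne'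
  have : 2 ^ 2 ∣ (2 ^ i + 2 ^ i).choose (2 ^ i) := ⟨v, by rw [hu, hv']; ring⟩
  rw [padicValNat_dvd_iff_le hu0, hv] at this
  omega

theorem even_choose_self_add_self {r : ℕ} (h : 0 < r) : 2 ∣ (r + r).choose r := by
  rw [← two_mul]
  exact Nat.two_dvd_centralBinom_of_one_le h

/-! ### The 2-adic size of the binomial coefficients `choose (n - 1 - r) r` -/

/-- Adding `r` and `n - 1 - 2 * r` in base 2 produces a carry into position `i`. -/
def IsCarry (n r i : ℕ) : Prop := 2 ^ i ≤ r % 2 ^ i + (n - 1 - 2 * r) % 2 ^ i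

instance (n r : ℕ) : DecidablePred (IsCarry n r) := fun i =>
  inferInstanceAs (Decidable (2 ^ i ≤ r % 2 ^ i + (n - 1 - 2 * r) % 2 ^ i))

theorem choose_eq_zero_of_le {n r : ℕ} (hn : 0 < n) (h : n ≤ 2 * r) :
    (n - 1 - r).choose r = 0 :=
  Nat.choose_eq_zero_of_lt (by omega)

theorem padicValNat_eq_card_carry {n r b : ℕ} (h : 2 * r < n) (hb : n ≤ b) :
    padicValNat 2 ((n - 1 - r).choose r) = ((Finset.Ico 1 b).filter (IsCarry n r)).card := by
  have := @padicValNat_choose 2 (n - 1 - r) r b ⟨Nat.prime_two⟩ (by omega)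
    (Nat.log_lt_of_lt_pow' (by omega) (by
      have := @Nat.lt_two_pow_self b
      omega))
  rw [this]
  congr 1
  ext i
  have e : n - 1 - r - r = n - 1 - 2 * r := by omega
  simp [IsCarry, e]

theorem card_carry_le {n r : ℕ} (h : 2 * r < n) (s : Finset ℕ) (hs : ∀ i ∈ s, 1 ≤ i ∧ IsCarry n r i) :
    s.card ≤ padicValNat 2 ((n - 1 - r).choose r) := by
  rw [padicValNat_eq_card_carry h (le_max_left n (s.sup id + 1))]
  apply Finset.card_le_card
  intro i hi
  have : i ≤ s.sup id := Finset.le_sup (f := id) hi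
  rw [Finset.mem_filter, Finset.mem_Ico]
  exact ⟨⟨(hs i hi).1, lt_of_lt_of_le (by omega) (le_max_right _ _)⟩, (hs i hi).2⟩

theorem odd_choose_iff {n r : ℕ} (h : 2 * r < n) :
    Odd ((n - 1 - r).choose r) ↔ ∀ i, 1 ≤ i → ¬ IsCarry n r i := by
  have h0 : (n - 1 - r).choose r ≠ 0 := (Nat.choose_pos (by omega)).ne'
  have h1 : Odd ((n - 1 - r).choose r) ↔ padicValNat 2 ((n - 1 - r).choose r) = 0 := by
    rw [padicValNat.eq_zero_iff, ← Nat.not_even_iff_odd, even_iff_two_dvd]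
    simp [h0]
  rw [h1]
  constructor
  · intro hv i hi hc
    have := card_carry_le h {i} (by simpa using ⟨hi, hc⟩)
    simp at this
    omega
  · intro hc
    rw [padicValNat_eq_card_carry h le_rfl, Finset.card_eq_zero, Finset.filter_eq_empty_iff]
    intro i hi
    exact hc i (Finset.mem_Ico.1 hi).1

theorem mod_two_pow_succ_eq (r i : ℕ) :
    r % 2 ^ (i + 1) = r % 2 ^ i ∨ r % 2 ^ (i + 1) = 2 ^ i + r % 2 ^ i := by
  rw [Nat.mod_pow_succ]
  rcases Nat.mod_two_eq_zero_or_one (r / 2 ^ i) with h | h <;> rw [h]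
  · simp
  · right; ring

theorem isCarry_of_high {e t n r i : ℕ}
    (hn' : n < 2 ^ e + 2 ^ (t + 1)) (h : 2 * r < n) (hn : 2 ^ e < n) (hie : i < e)
    (hbit : r % 2 ^ (i + 1) = 2 ^ i + r % 2 ^ i) (hr : 2 ^ t ≤ r % 2 ^ i) :
    IsCarry n r (i + 1) := by
  unfold IsCarry
  by_contra hc
  rw [not_le, hbit] at hc
  obtain ⟨g, rfl⟩ : ∃ g, e = i + 1 + g := ⟨e - (i + 1), by omega⟩
  have e1 := Nat.div_add_mod r (2 ^ (i + 1))
  have e2 := Nat.div_add_mod (n - 1 - 2 * r) (2 ^ (i + 1))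
  rw [hbit] at e1
  set A := r / 2 ^ (i + 1)
  set C := (n - 1 - 2 * r) / 2 ^ (i + 1)
  set m := (n - 1 - 2 * r) % 2 ^ (i + 1)
  set ρ := r % 2 ^ i
  have hρ : ρ < 2 ^ i := Nat.mod_lt _ (by positivity)
  set Q := 2 ^ (i + 1) with hQ
  have hQ2 : Q = 2 * 2 ^ i := by rw [hQ, pow_succ']
  have key : (n - 1 - 2 ^ (i + 1 + g)) + Q * 2 ^ g = (m + 2 * ρ) + Q * (C + 2 * A + 1) := by
    have : 2 ^ (i + 1 + g) = Q * 2 ^ g := by rw [pow_add]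
    rw [this] at hn ⊢
    have : n - 1 = 2 * r + (n - 1 - 2 * r) := by omega
    have e3 : Q * (C + 2 * A + 1) = Q * C + 2 * (Q * A) + Q := by ring
    omega
  have h2 := congrArg (· % Q) key
  simp only [Nat.add_mul_mod_self_left] at h2
  rw [Nat.mod_eq_of_lt (a := m + 2 * ρ) (by omega)] at h2
  have h3 := Nat.mod_le (n - 1 - 2 ^ (i + 1 + g)) Q
  rw [pow_succ] at hn'
  omega

theorem isCarry_of_bit {n r w : ℕ} (hw : 2 ^ (w + 1) ∣ n) (h : 2 * r < n)
    (hbit : r % 2 ^ (w + 1) = 2 ^ w + r % 2 ^ w) : IsCarry n r (w + 1) := by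
  unfold IsCarry
  rw [hbit]
  obtain ⟨k, hk⟩ := hw
  have e1 := Nat.div_add_mod r (2 ^ (w + 1))
  have e2 := Nat.div_add_mod (n - 1 - 2 * r) (2 ^ (w + 1))
  rw [hbit] at e1
  set A := r / 2 ^ (w + 1)
  set C := (n - 1 - 2 * r) / 2 ^ (w + 1)
  set m := (n - 1 - 2 * r) % 2 ^ (w + 1)
  set ρ := r % 2 ^ w
  have hρ : ρ < 2 ^ w := Nat.mod_lt _ (by positivity)
  set Q := 2 ^ (w + 1) with hQ
  have hQ2 : Q = 2 * 2 ^ w := by rw [hQ, pow_succ']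
  have key : (m + 2 * ρ + 1) + Q * (C + 2 * A + 1) = Q * k := by
    have e3 : Q * (C + 2 * A + 1) = Q * C + 2 * (Q * A) + Q := by ring
    omega
  have hd : Q ∣ m + 2 * ρ + 1 :=
    (Nat.dvd_add_left (Dvd.intro _ rfl)).1 (key ▸ Dvd.intro k rfl)
  have := Nat.le_of_dvd (by omega) hd
  omega

theorem isCarry_succ_of_bit {n r w : ℕ} (hw : 2 ^ (w + 1) ∣ n) (hw' : ¬ 2 ^ (w + 2) ∣ n)
    (h : 2 * r < n) (hbit : r % 2 ^ (w + 1) = 2 ^ w + r % 2 ^ w) : IsCarry n r (w + 2) := by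
  unfold IsCarry
  obtain ⟨k, hk⟩ := hw
  have hbit2 := mod_two_pow_succ_eq r (w + 1)
  rw [hbit] at hbit2
  have e1 := Nat.div_add_mod r (2 ^ (w + 2))
  have e2 := Nat.div_add_mod (n - 1 - 2 * r) (2 ^ (w + 2))
  set A := r / 2 ^ (w + 2)
  set C := (n - 1 - 2 * r) / 2 ^ (w + 2)
  set m := (n - 1 - 2 * r) % 2 ^ (w + 2)
  set ρ := r % 2 ^ w
  have hρ : ρ < 2 ^ w := Nat.mod_lt _ (by positivity)
  have hQ1 : 2 ^ (w + 1) = 2 * 2 ^ w := by rw [pow_succ']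
  have hQ2 : 2 ^ (w + 2) = 4 * 2 ^ w := by ring
  rw [hQ1] at hbit2 hk
  change r % 2 ^ (w + 2) = _ ∨ r % 2 ^ (w + 2) = _ at hbit2
  set s := r % 2 ^ (w + 2)
  set M := 2 ^ (w + 2)
  have hkodd : ¬ 2 ∣ k := by
    rintro ⟨l, rfl⟩
    exact hw' ⟨l, by rw [hk]; ring⟩
  obtain ⟨l, rfl⟩ : ∃ l, k = 2 * l + 1 := ⟨k / 2, by omega⟩
  have hd : M ∣ m + 2 * ρ + 1 := by
    rcases hbit2 with hb | hb
    · have key : (m + 2 * ρ + 1) + M * (C + 2 * A) = M * l := by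
        have e3 : M * (C + 2 * A) = M * C + 2 * (M * A) := by ring
        have e4 : 2 * 2 ^ w * (2 * l + 1) = M * l + 2 * 2 ^ w := by rw [hQ2]; ring
        omega
      exact (Nat.dvd_add_left (Dvd.intro _ rfl)).1 (key ▸ Dvd.intro l rfl)
    · have key : (m + 2 * ρ + 1) + M * (C + 2 * A + 1) = M * l := by
        have e3 : M * (C + 2 * A + 1) = M * C + 2 * (M * A) + M := by ring
        have e4 : 2 * 2 ^ w * (2 * l + 1) = M * l + 2 * 2 ^ w := by rw [hQ2]; ring
        omega
      exact (Nat.dvd_add_left (Dvd.intro _ rfl)).1 (key ▸ Dvd.intro l rfl)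
  have := Nat.le_of_dvd (by omega) hd
  omega

theorem highAlpha_add_card_le {e t n r : ℕ} (hn' : n < 2 ^ e + 2 ^ (t + 1)) (hn : 2 ^ e < n)
    (h : 2 * r < n) {i : ℕ} (hti : t ≤ i) (hie : i ≤ e) :
    highAlpha t (r % 2 ^ i) + ((Finset.Ico 1 (t + 1)).filter (IsCarry n r)).card ≤
      1 + ((Finset.Ico 1 (i + 1)).filter (IsCarry n r)).card := by
  induction i, hti using Nat.le_induction with
  | base =>
    rw [highAlpha_of_lt (Nat.mod_lt _ (by positivity))]
    omega
  | succ i hti ih =>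
    specialize ih (by omega)
    have hsub : ((Finset.Ico 1 (i + 1)).filter (IsCarry n r)).card ≤
        ((Finset.Ico 1 (i + 1 + 1)).filter (IsCarry n r)).card :=
      Finset.card_le_card (Finset.filter_subset_filter _ (Finset.Ico_subset_Ico_right (by omega)))
    rcases mod_two_pow_succ_eq r i with hb | hb
    · rw [hb]; omega
    · have hadd : highAlpha t (r % 2 ^ (i + 1)) ≤ 1 + highAlpha t (r % 2 ^ i) := by
        unfold highAlpha
        have e1 : 2 ^ i = 2 ^ t * 2 ^ (i - t) := by rw [← pow_add]; congr 1; omega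
        rw [hb]
        nth_rewrite 1 [e1]
        rw [Nat.mul_add_div (by positivity)]
        exact (alpha_add_le _ _).trans (by rw [alpha_two_pow])
      rcases lt_or_ge (r % 2 ^ i) (2 ^ t) with hl | hl
      · rw [highAlpha_of_lt hl] at hadd
        have : ((Finset.Ico 1 (t + 1)).filter (IsCarry n r)).card ≤
            ((Finset.Ico 1 (i + 1 + 1)).filter (IsCarry n r)).card :=
          Finset.card_le_card
            (Finset.filter_subset_filter _ (Finset.Ico_subset_Ico_right (by omega)))
        omega
      · have hc : IsCarry n r (i + 1) := isCarry_of_high hn' h hn (by omega) hb hl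
        have : ((Finset.Ico 1 (i + 1 + 1)).filter (IsCarry n r)).card =
            ((Finset.Ico 1 (i + 1)).filter (IsCarry n r)).card + 1 := by
          rw [← Finset.insert_Ico_right_eq_Ico_add_one (by omega : 1 ≤ i + 1),
            Finset.filter_insert, if_pos hc, Finset.card_insert_of_notMem (by simp)]
        omega

theorem highAlpha_add_card_le_padicValNat {e t n r : ℕ} (hte : t < e)
    (hn' : n < 2 ^ e + 2 ^ (t + 1)) (hn : 2 ^ e < n) (h : 2 * r < n) :
    highAlpha t r + ((Finset.Ico 1 (t + 1)).filter (IsCarry n r)).card ≤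
      1 + padicValNat 2 ((n - 1 - r).choose r) := by
  have h1 := highAlpha_add_card_le hn' hn h hte.le le_rfl
  have h2 : 2 ^ (t + 1) ≤ 2 ^ e := Nat.pow_le_pow_right (by norm_num) hte
  rw [Nat.mod_eq_of_lt (by omega)] at h1
  have h3 := card_carry_le h ((Finset.Ico 1 (e + 1)).filter (IsCarry n r)) (by
    intro i hi
    rw [Finset.mem_filter, Finset.mem_Ico] at hi
    exact ⟨hi.1.1, hi.2⟩)
  omega

theorem two_pow_highAlpha_dvd_two_mul_choose {e t n : ℕ} (hte : t < e)
    (hn' : n < 2 ^ e + 2 ^ (t + 1)) (hn : 2 ^ e < n) (r : ℕ) :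
    2 ^ highAlpha t r ∣ 2 * (n - 1 - r).choose r := by
  rcases lt_or_ge (2 * r) n with h | h
  · have := highAlpha_add_card_le_padicValNat hte hn' hn h
    exact (pow_dvd_pow 2 ((Nat.le_add_right _ _).trans this)).trans
      (by rw [pow_add, pow_one]; exact mul_dvd_mul_left _ pow_padicValNat_dvd)
  · simp [choose_eq_zero_of_le (Nat.zero_lt_of_lt hn) h]

theorem two_pow_highAlpha_dvd_choose {e t n w r : ℕ} (hte : t < e)
    (hn' : n < 2 ^ e + 2 ^ (t + 1)) (hn : 2 ^ e < n) (hwt : w < t) (hw : 2 ^ (w + 1) ∣ n)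
    (hbit : r % 2 ^ (w + 1) = 2 ^ w + r % 2 ^ w) :
    2 ^ highAlpha t r ∣ (n - 1 - r).choose r := by
  rcases lt_or_ge (2 * r) n with h | h
  · have h1 := highAlpha_add_card_le_padicValNat hte hn' hn h
    have : 0 < ((Finset.Ico 1 (t + 1)).filter (IsCarry n r)).card :=
      Finset.card_pos.2 ⟨w + 1, by
        rw [Finset.mem_filter, Finset.mem_Ico]
        exact ⟨⟨by omega, by omega⟩, isCarry_of_bit hw h hbit⟩⟩
    exact two_pow_dvd_of_le_padicValNat (by omega)
  · simp [choose_eq_zero_of_le (Nat.zero_lt_of_lt hn) h]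

theorem exists_bit {r w : ℕ} (hr : r % 2 ^ (w + 1) ≠ 0) :
    ∃ i ≤ w, r % 2 ^ (i + 1) = 2 ^ i + r % 2 ^ i := by
  induction w with
  | zero =>
    rcases mod_two_pow_succ_eq r 0 with h | h
    · rw [h] at hr
      simp [Nat.mod_one] at hr
    · exact ⟨0, le_rfl, h⟩
  | succ w ih =>
    rcases mod_two_pow_succ_eq r (w + 1) with h | h
    · rw [h] at hr
      obtain ⟨i, hi, hh⟩ := ih hr
      exact ⟨i, by omega, hh⟩
    · exact ⟨w + 1, le_rfl, h⟩

theorem two_dvd_choose_of_mod_ne_zero {n r w : ℕ} (hn : 0 < n) (hw : 2 ^ (w + 1) ∣ n)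
    (hr : r % 2 ^ (w + 1) ≠ 0) : 2 ∣ (n - 1 - r).choose r := by
  rcases lt_or_ge (2 * r) n with h | h
  · obtain ⟨i, hi, hb⟩ := exists_bit hr
    have hc := isCarry_of_bit ((pow_dvd_pow 2 (by omega)).trans hw) h hb
    have := card_carry_le h {i + 1} (by simpa using hc)
    simpa using two_pow_dvd_of_le_padicValNat this
  · simp [choose_eq_zero_of_le hn h]

theorem four_dvd_choose_of_bit {n r w : ℕ} (hn : 0 < n) (hw : 2 ^ (w + 1) ∣ n)
    (hw' : ¬ 2 ^ (w + 2) ∣ n) (hbit : r % 2 ^ (w + 1) = 2 ^ w + r % 2 ^ w) :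
    4 ∣ (n - 1 - r).choose r := by
  rcases lt_or_ge (2 * r) n with h | h
  · have h1 := isCarry_of_bit hw h hbit
    have h2 := isCarry_succ_of_bit hw hw' h hbit
    have := card_carry_le h {w + 1, w + 2} (by simpa using ⟨h1, h2⟩)
    rw [Finset.card_pair (by omega)] at this
    exact two_pow_dvd_of_le_padicValNat this
  · simp [choose_eq_zero_of_le hn h]

theorem two_mul_lt_of_odd_choose {n p : ℕ} (hn : 0 < n) (h : Odd ((n - 1 - p).choose p)) :
    2 * p < n := by
  by_contra hc
  rw [choose_eq_zero_of_le hn (by omega)] at h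
  simp at h

theorem two_mul_mod_le {e t n p : ℕ} (hte : t < e) (hn : 2 ^ e + 2 ^ t ≤ n)
    (h : Odd ((n - 1 - p).choose p)) :
    2 * (p % 2 ^ t) ≤ n - 1 - 2 ^ e := by
  rcases Nat.eq_zero_or_pos t with rfl | ht
  · simp [Nat.mod_one]
  have hT : 0 < 2 ^ t := by positivity
  have hp := two_mul_lt_of_odd_choose (lt_of_lt_of_le (by positivity) hn) h
  have hc := (odd_choose_iff hp).1 h t ht
  unfold IsCarry at hc
  obtain ⟨g, rfl⟩ : ∃ g, e = t + g := ⟨e - t, by omega⟩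
  rw [pow_add] at *
  have e1 := Nat.div_add_mod p (2 ^ t)
  have e2 := Nat.div_add_mod (n - 1 - 2 * p) (2 ^ t)
  set A := p / 2 ^ t
  set C := (n - 1 - 2 * p) / 2 ^ t
  set m := (n - 1 - 2 * p) % 2 ^ t
  set ρ := p % 2 ^ t
  set Q := 2 ^ t
  by_contra hlt
  rw [not_le] at hlt hc
  have key : (n - 1 - Q * 2 ^ g) + Q * 2 ^ g = (m + 2 * ρ) + Q * (C + 2 * A) := by
    have e3 : Q * (C + 2 * A) = Q * C + 2 * (Q * A) := by ring
    omega
  have h3 : Q * 2 ^ g < Q * (C + 2 * A) + Q := by omega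
  have h4 : Q * (C + 2 * A) < Q * 2 ^ g := by omega
  have h5 : 2 ^ g < C + 2 * A + 1 := Nat.lt_of_mul_lt_mul_left (by rw [mul_add, mul_one]; exact h3)
  have h6 : C + 2 * A < 2 ^ g := Nat.lt_of_mul_lt_mul_left h4
  omega

theorem sub_lt_of_bit {e t n p : ℕ} (hte : t < e) (hn : 2 ^ e + 2 ^ t ≤ n)
    (hn' : n < 2 ^ e + 2 ^ (t + 1)) (h : Odd ((n - 1 - p).choose p))
    (hbit : p % 2 ^ (t + 1) = 2 ^ t + p % 2 ^ t) :
    n - 1 - 2 ^ e < 2 ^ t + p % 2 ^ t := by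
  have hT : 0 < 2 ^ t := by positivity
  have hp := two_mul_lt_of_odd_choose (lt_of_lt_of_le (by positivity) hn) h
  have hc := (odd_choose_iff hp).1 h (t + 1) (by omega)
  unfold IsCarry at hc
  obtain ⟨g, rfl⟩ : ∃ g, e = t + 1 + g := ⟨e - (t + 1), by omega⟩
  have e1 := Nat.div_add_mod p (2 ^ (t + 1))
  have e2 := Nat.div_add_mod (n - 1 - 2 * p) (2 ^ (t + 1))
  have hQ2 : 2 ^ (t + 1) = 2 * 2 ^ t := pow_succ' _ _
  have hρ : p % 2 ^ t < 2 ^ t := Nat.mod_lt _ (by positivity)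
  rw [hbit] at e1 hc
  set A := p / 2 ^ (t + 1)
  set C := (n - 1 - 2 * p) / 2 ^ (t + 1)
  set m := (n - 1 - 2 * p) % 2 ^ (t + 1)
  set ρ := p % 2 ^ t with hρdef
  rw [not_le] at hc
  have e4 : 2 ^ (t + 1 + g) = 2 ^ (t + 1) * 2 ^ g := by rw [pow_add]
  rw [e4] at hn hn' ⊢
  set Q := 2 ^ (t + 1)
  have key : (n - 1 - Q * 2 ^ g) + Q * 2 ^ g = (m + 2 * ρ) + Q * (C + 2 * A + 1) := by
    have e3 : Q * (C + 2 * A + 1) = Q * C + 2 * (Q * A) + Q := by ring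
    omega
  have h2 := congrArg (· % Q) key
  simp only [Nat.add_mul_mod_self_left] at h2
  rw [Nat.mod_eq_of_lt (a := m + 2 * ρ) (by omega), Nat.mod_eq_of_lt (by omega)] at h2
  omega

theorem odd_choose_two_pow_add_mod {e t n p : ℕ} (hte : t < e) (hn : 2 ^ e + 2 ^ t ≤ n)
    (hn' : n < 2 ^ e + 2 ^ (t + 1)) (h : Odd ((n - 1 - p).choose p))
    (hlast : t + 1 = e → n - 1 - 2 ^ e < 2 ^ t + p % 2 ^ t) :
    Odd ((n - 1 - (2 ^ (e - 1) + p % 2 ^ t)).choose (2 ^ (e - 1) + p % 2 ^ t)) := by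
  have h0 := two_mul_mod_le hte hn h
  have hp := two_mul_lt_of_odd_choose (lt_of_lt_of_le (by positivity) hn) h
  have he : 2 ^ e = 2 * 2 ^ (e - 1) := by rw [← pow_succ']; congr 1; omega
  have ht2 : 2 ^ (t + 1) = 2 * 2 ^ t := pow_succ' _ _
  have hρ : p % 2 ^ t < 2 ^ t := Nat.mod_lt _ (by positivity)
  rw [odd_choose_iff (by omega)]
  intro i hi
  unfold IsCarry
  rw [not_le]
  set ρ := p % 2 ^ t with hρdef
  have e5 : n - 1 - 2 * (2 ^ (e - 1) + ρ) = n - 1 - 2 ^ e - 2 * ρ := by omega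
  rcases le_or_gt i t with hit | hit
  · have hc := (odd_choose_iff hp).1 h i hi
    unfold IsCarry at hc
    rw [not_le] at hc
    have hd : 2 ^ i ∣ 2 ^ (e - 1) := pow_dvd_pow 2 (by omega)
    have e1 : (2 ^ (e - 1) + ρ) % 2 ^ i = p % 2 ^ i := by
      rw [Nat.add_mod, Nat.mod_eq_zero_of_dvd hd, zero_add, Nat.mod_mod, hρdef,
        Nat.mod_mod_of_dvd _ (pow_dvd_pow 2 hit)]
    have e2 : (n - 1 - 2 * (2 ^ (e - 1) + ρ)) % 2 ^ i = (n - 1 - 2 * p) % 2 ^ i := by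
      have h1 : (2 ^ (e - 1) + ρ) ≡ p [MOD 2 ^ i] := e1
      have h2 := h1.mul_left 2
      apply Nat.ModEq.add_left_cancel h2
      have e3 : 2 * (2 ^ (e - 1) + ρ) + (n - 1 - 2 * (2 ^ (e - 1) + ρ)) = n - 1 := by omega
      have e4 : 2 * p + (n - 1 - 2 * p) = n - 1 := by omega
      rw [e3, e4]
    rw [e1, e2]; exact hc
  · have hi2 : 2 ^ (t + 1) ≤ 2 ^ i := Nat.pow_le_pow_right (by norm_num) hit
    rw [e5]
    have h1 := Nat.mod_le (n - 1 - 2 ^ e - 2 * ρ) (2 ^ i)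
    rcases le_or_gt e i with hei | hei
    · have hi3 : 2 ^ e ≤ 2 ^ i := Nat.pow_le_pow_right (by norm_num) hei
      have h2 := Nat.mod_le (2 ^ (e - 1) + ρ) (2 ^ i)
      rcases Nat.eq_or_lt_of_le (Nat.succ_le_of_lt hte) with hl | hl
      · have := hlast hl
        have : 2 ^ (e - 1) = 2 ^ t := by congr 1; omega
        omega
      · have : 2 ^ (t + 1) ≤ 2 ^ (e - 1) := Nat.pow_le_pow_right (by norm_num) (by omega)
        omega
    · have hd : 2 ^ i ∣ 2 ^ (e - 1) := pow_dvd_pow 2 (by omega)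
      have e1 : (2 ^ (e - 1) + ρ) % 2 ^ i = ρ := by
        rw [Nat.add_mod, Nat.mod_eq_zero_of_dvd hd, zero_add, Nat.mod_mod,
          Nat.mod_eq_of_lt (by omega)]
      omega

/-! ### The functions `4 ^ r * choose j r` and the lattices they span -/

/-- The function `j ↦ 4 ^ r * choose j r` on `{0, …, J - 1}`. -/
def basisFun (J r : ℕ) : Fin J → ℚ := fun j => 4 ^ r * ((j : ℕ).choose r : ℚ)

theorem basisFun_zero (J : ℕ) : basisFun J 0 = 1 := by
  ext j; simp [basisFun]

theorem basisFun_eq_zero {J r : ℕ} (h : J ≤ r) : basisFun J r = 0 := by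
  ext j
  simp [basisFun, Nat.choose_eq_zero_of_lt (lt_of_lt_of_le j.2 h)]

theorem choose_mul_choose_eq_sum (j r s : ℕ) :
    j.choose r * j.choose s =
      ∑ d ∈ Finset.range (s + 1), (r + (s - d)).choose r * r.choose d * j.choose (r + (s - d)) := by
  rcases lt_or_ge j r with h | h
  · rw [Nat.choose_eq_zero_of_lt h, zero_mul, eq_comm]
    exact Finset.sum_eq_zero fun d _ => by
      rw [Nat.choose_eq_zero_of_lt (show j < r + (s - d) by omega), mul_zero]
  · obtain ⟨m, rfl⟩ := Nat.exists_eq_add_of_le h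
    conv_lhs => rw [Nat.add_choose_eq r m s]
    rw [Finset.Nat.sum_antidiagonal_eq_sum_range_succ (fun a b => r.choose a * m.choose b),
      Finset.mul_sum]
    refine Finset.sum_congr rfl fun d _ => ?_
    have := Nat.choose_mul (n := r + m) (k := r + (s - d)) (s := r) (by omega)
    rw [Nat.add_sub_cancel_left, Nat.add_sub_cancel_left] at this
    calc _ = r.choose d * ((r + m).choose r * m.choose (s - d)) := by ring
      _ = _ := by rw [← this]; ring

theorem basisFun_mul (J r s : ℕ) :
    basisFun J r * basisFun J s = ∑ d ∈ Finset.range (s + 1),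
      ((4 ^ d * (r + (s - d)).choose r * r.choose d : ℕ) : ℚ) • basisFun J (r + (s - d)) := by
  ext j
  have := congrArg (Nat.cast : ℕ → ℚ) (choose_mul_choose_eq_sum j r s)
  push_cast at this
  simp only [basisFun, Pi.mul_apply, Finset.sum_apply, Pi.smul_apply, smul_eq_mul]
  calc _ = 4 ^ r * 4 ^ s * (((j : ℕ).choose r : ℚ) * ((j : ℕ).choose s : ℚ)) := by ring
    _ = _ := by
      rw [this, Finset.mul_sum]
      refine Finset.sum_congr rfl fun d hd => ?_
      obtain ⟨c, rfl⟩ := Nat.exists_eq_add_of_le (Nat.lt_succ_iff.1 (Finset.mem_range.1 hd))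
      rw [Nat.add_sub_cancel_left]
      push_cast
      ring

/-- Exponents `ω r` for which the span of the `2 ^ (-ω r) * basisFun J r` is a ring. -/
structure IsWeight (ω : ℕ → ℕ) : Prop where
  zero : ω 0 = 0
  dvd : ∀ r s, 2 ^ (ω r + ω s) ∣ 2 ^ ω (r + s) * (r + s).choose r
  add_le : ∀ s d, ω (s + d) ≤ ω s + d

theorem isWeight_zero : IsWeight (fun _ => 0) := ⟨rfl, by simp, by simp⟩

theorem isWeight_highAlpha (t : ℕ) : IsWeight (highAlpha t) :=
  ⟨by simp [highAlpha], two_pow_highAlpha_dvd t, highAlpha_add_le_add t⟩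

/-- The additive group spanned by the functions `2 ^ (-ω r) * basisFun J r`. -/
def weightLattice (J : ℕ) (ω : ℕ → ℕ) : AddSubgroup (Fin J → ℚ) :=
  AddSubgroup.closure (Set.range fun r => ((2 : ℚ) ^ ω r)⁻¹ • basisFun J r)

theorem gen_mem {J : ℕ} {ω : ℕ → ℕ} (r : ℕ) :
    ((2 : ℚ) ^ ω r)⁻¹ • basisFun J r ∈ weightLattice J ω :=
  AddSubgroup.subset_closure ⟨r, rfl⟩

theorem natCast_smul_mem {J : ℕ} {G : AddSubgroup (Fin J → ℚ)} {f : Fin J → ℚ} (hf : f ∈ G)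
    (m : ℕ) : (m : ℚ) • f ∈ G := by
  have := G.nsmul_mem hf m
  rwa [← Nat.cast_smul_eq_nsmul ℚ] at this

theorem intCast_smul_mem {J : ℕ} {G : AddSubgroup (Fin J → ℚ)} {f : Fin J → ℚ} (hf : f ∈ G)
    (m : ℤ) : (m : ℚ) • f ∈ G := by
  have := G.zsmul_mem hf m
  rwa [← Int.cast_smul_eq_zsmul ℚ] at this

theorem smul_basisFun_mem {J : ℕ} {ω : ℕ → ℕ} {a b r : ℕ} (h : 2 ^ b ∣ 2 ^ ω r * a) :
    ((2 : ℚ) ^ b)⁻¹ • (a : ℚ) • basisFun J r ∈ weightLattice J ω := by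
  obtain ⟨c, hc⟩ := h
  have : ((2 : ℚ) ^ b)⁻¹ • (a : ℚ) • basisFun J r
      = (c : ℚ) • ((2 : ℚ) ^ ω r)⁻¹ • basisFun J r := by
    rw [smul_smul, smul_smul]
    congr 1
    have := congrArg (Nat.cast : ℕ → ℚ) hc
    push_cast at this
    field_simp
    linarith
  rw [this]
  exact natCast_smul_mem (gen_mem r) c

/-- The `d`-th term of the product of two generators is divisible by `2 ^ d`. -/
theorem gen_mul_term_mem {J : ℕ} {ω : ℕ → ℕ} (h : IsWeight ω) {r s d : ℕ} (hd : d ≤ s) :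
    ((2 : ℚ) ^ (ω r + ω s + d))⁻¹ • ((4 ^ d * (r + (s - d)).choose r * r.choose d : ℕ) : ℚ) •
      basisFun J (r + (s - d)) ∈ weightLattice J ω := by
  apply smul_basisFun_mem
  have h1 := h.add_le (s - d) d
  rw [Nat.sub_add_cancel hd] at h1
  calc 2 ^ (ω r + ω s + d) ∣ 2 ^ (ω r + (ω (s - d) + 2 * d)) := pow_dvd_pow 2 (by omega)
    _ = 2 ^ (ω r + ω (s - d)) * 4 ^ d := by rw [← add_assoc, pow_add, pow_mul]; norm_num
    _ ∣ 2 ^ ω (r + (s - d)) * (r + (s - d)).choose r * 4 ^ d :=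
      mul_dvd_mul_right (h.dvd r (s - d)) _
    _ ∣ 2 ^ ω (r + (s - d)) * (4 ^ d * (r + (s - d)).choose r * r.choose d) :=
      ⟨r.choose d, by ring⟩

/-- The product of two generators is its leading term, up to multiples of `2`. -/
theorem gen_mul_gen_eq {J : ℕ} {ω : ℕ → ℕ} (h : IsWeight ω) (r s : ℕ) :
    ∃ a ∈ weightLattice J ω,
      (((2 : ℚ) ^ ω r)⁻¹ • basisFun J r) * (((2 : ℚ) ^ ω s)⁻¹ • basisFun J s) =
        ((2 : ℚ) ^ (ω r + ω s))⁻¹ • ((r + s).choose r : ℚ) • basisFun J (r + s) + (2 : ℚ) • a := by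
  refine ⟨∑ d ∈ Finset.range s, ((2 ^ d : ℕ) : ℚ) • (((2 : ℚ) ^ (ω r + ω s + (d + 1)))⁻¹ •
    ((4 ^ (d + 1) * (r + (s - (d + 1))).choose r * r.choose (d + 1) : ℕ) : ℚ) •
      basisFun J (r + (s - (d + 1)))), sum_mem fun d hd => natCast_smul_mem
        (gen_mul_term_mem h (Finset.mem_range.1 hd)) _, ?_⟩
  rw [smul_mul_smul_comm, basisFun_mul, ← mul_inv, ← pow_add, Finset.sum_range_succ', smul_add,
    Finset.smul_sum, Finset.smul_sum]
  refine (add_comm _ _).trans ?_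
  congr 1
  · simp
  · refine Finset.sum_congr rfl fun d _ => ?_
    simp only [smul_smul]
    congr 1
    push_cast
    field_simp
    ring

theorem gen_mul_gen_mem {J : ℕ} {ω : ℕ → ℕ} (h : IsWeight ω) (r s : ℕ) :
    (((2 : ℚ) ^ ω r)⁻¹ • basisFun J r) * (((2 : ℚ) ^ ω s)⁻¹ • basisFun J s) ∈
      weightLattice J ω := by
  obtain ⟨a, ha, hmul⟩ := gen_mul_gen_eq (J := J) h r s
  rw [hmul, two_smul]
  exact add_mem (smul_basisFun_mem (h.dvd r s)) (add_mem ha ha)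

/-- The ring spanned by the functions `2 ^ (-ω r) * basisFun J r`. -/
def weightRing (J : ℕ) {ω : ℕ → ℕ} (h : IsWeight ω) : Subring (Fin J → ℚ) :=
  { weightLattice J ω with
    mul_mem' := by
      intro f g hf hg
      change f ∈ weightLattice J ω at hf
      change g ∈ weightLattice J ω at hg
      change f * g ∈ weightLattice J ω
      induction hf using AddSubgroup.closure_induction with
      | mem f hf =>
        obtain ⟨r, rfl⟩ := hf
        induction hg using AddSubgroup.closure_induction with
        | mem g hg =>
          obtain ⟨s, rfl⟩ := hg
          exact gen_mul_gen_mem h r s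
        | zero => rw [mul_zero]; exact zero_mem _
        | add g g' _ _ h1 h2 => rw [mul_add]; exact add_mem h1 h2
        | neg g _ h1 => rw [mul_neg]; exact neg_mem h1
      | zero => rw [zero_mul]; exact zero_mem _
      | add f f' _ _ h1 h2 => rw [add_mul]; exact add_mem h1 h2
      | neg f _ h1 => rw [neg_mul]; exact neg_mem h1
    one_mem' := by
      change 1 ∈ weightLattice J ω
      have := gen_mem (J := J) (ω := ω) 0
      simpa [h.zero, basisFun_zero] using this }

/-- The ring spanned by the functions `basisFun J r`. -/
def baseRing (J : ℕ) : Subring (Fin J → ℚ) := weightRing J isWeight_zero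

/-- The ring spanned by the functions `2 ^ (-highAlpha t r) * basisFun J r`. -/
def highRing (J t : ℕ) : Subring (Fin J → ℚ) := weightRing J (isWeight_highAlpha t)

theorem basisFun_mem (J r : ℕ) : basisFun J r ∈ baseRing J := by
  have h := gen_mem (J := J) (ω := fun _ => 0) r
  rw [pow_zero, inv_one, one_smul] at h
  exact h

theorem baseRing_le (J t : ℕ) : baseRing J ≤ highRing J t := by
  intro f hf
  change f ∈ weightLattice J _ at hf
  change f ∈ weightLattice J _
  induction hf using AddSubgroup.closure_induction with
  | mem f hf =>
    obtain ⟨r, rfl⟩ := hf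
    have := smul_basisFun_mem (J := J) (ω := highAlpha t) (a := 1) (b := 0) (r := r) (by simp)
    simpa using this
  | zero => exact zero_mem _
  | add f f' _ _ h1 h2 => exact add_mem h1 h2
  | neg f _ h1 => exact neg_mem h1

theorem baseRing_induction {J : ℕ} {P : (Fin J → ℚ) → Prop} (hgen : ∀ r, P (basisFun J r))
    (h0 : P 0) (hadd : ∀ f g, P f → P g → P (f + g)) (hneg : ∀ f, P f → P (-f))
    {f : Fin J → ℚ} (hf : f ∈ baseRing J) : P f := by
  change f ∈ weightLattice J _ at hf
  induction hf using AddSubgroup.closure_induction with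
  | mem f hf => obtain ⟨r, rfl⟩ := hf; simpa using hgen r
  | zero => exact h0
  | add f f' _ _ h1 h2 => exact hadd _ _ h1 h2
  | neg f _ h1 => exact hneg _ h1

theorem highRing_induction {J t : ℕ} {P : (Fin J → ℚ) → Prop}
    (hgen : ∀ r, P (((2 : ℚ) ^ highAlpha t r)⁻¹ • basisFun J r))
    (h0 : P 0) (hadd : ∀ f g, P f → P g → P (f + g)) (hneg : ∀ f, P f → P (-f))
    {f : Fin J → ℚ} (hf : f ∈ highRing J t) : P f := by
  change f ∈ weightLattice J _ at hf
  induction hf using AddSubgroup.closure_induction with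
  | mem f hf => obtain ⟨r, rfl⟩ := hf; exact hgen r
  | zero => exact h0
  | add f f' _ _ h1 h2 => exact hadd _ _ h1 h2
  | neg f _ h1 => exact hneg _ h1

/-- `basisFun J r` is twice an element of `highRing J t` when `r` has a digit 1 in a position
`≥ t`. -/
theorem half_basisFun_mem {J t r : ℕ} (h : 2 ^ t ≤ r) :
    (2⁻¹ : ℚ) • basisFun J r ∈ highRing J t := by
  have h1 : 2 ^ 1 ∣ 2 ^ highAlpha t r * 1 := by
    rw [mul_one]; exact pow_dvd_pow 2 (highAlpha_pos h)
  have h2 := smul_basisFun_mem (J := J) h1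
  rw [pow_one, Nat.cast_one, one_smul] at h2
  exact h2

theorem basisFun_mul_eq (J r s : ℕ) : ∃ a ∈ baseRing J,
    basisFun J r * basisFun J s = ((r + s).choose r : ℚ) • basisFun J (r + s) + (4 : ℚ) • a := by
  refine ⟨∑ d ∈ Finset.range s,
    ((4 ^ d * (r + (s - (d + 1))).choose r * r.choose (d + 1) : ℕ) : ℚ) •
      basisFun J (r + (s - (d + 1))), sum_mem fun d _ => natCast_smul_mem (G := weightLattice J _)
        (basisFun_mem J _) _, ?_⟩
  rw [basisFun_mul, Finset.sum_range_succ', add_comm, Finset.smul_sum]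
  congr 1
  · simp
  · refine Finset.sum_congr rfl fun d _ => ?_
    rw [smul_smul]
    push_cast
    ring_nf

theorem basisFun_mul_self_eq (J : ℕ) {r : ℕ} (hr : 0 < r) : ∃ a ∈ baseRing J,
    basisFun J r * basisFun J r = ((r + r).choose r : ℚ) • basisFun J (r + r) +
      ((4 * r : ℕ) : ℚ) • ((r + (r - 1)).choose r : ℚ) • basisFun J (r + (r - 1)) +
      (16 : ℚ) • a := by
  obtain ⟨s, rfl⟩ : ∃ s, r = s + 1 := ⟨r - 1, by omega⟩
  refine ⟨∑ d ∈ Finset.range s,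
    ((4 ^ d * (s + 1 + (s + 1 - (d + 2))).choose (s + 1) * (s + 1).choose (d + 2) : ℕ) : ℚ) •
      basisFun J (s + 1 + (s + 1 - (d + 2))),
      sum_mem fun d _ => natCast_smul_mem (G := weightLattice J _) (basisFun_mem J _) _, ?_⟩
  rw [basisFun_mul, Finset.sum_range_succ', Finset.sum_range_succ', add_comm, Finset.smul_sum]
  rw [add_comm (∑ d ∈ _, _), ← add_assoc]
  congr 1
  · congr 1
    · simp
    · rw [smul_smul]
      simp
      ring_nf
  · refine Finset.sum_congr rfl fun d _ => ?_
    rw [smul_smul, add_assoc d 1 1]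
    push_cast
    ring_nf

theorem gen_mul_basisFun_eq (J t r s : ℕ) : ∃ a ∈ highRing J t,
    (((2 : ℚ) ^ highAlpha t r)⁻¹ • basisFun J r) * basisFun J s =
      ((2 : ℚ) ^ highAlpha t r)⁻¹ • ((r + s).choose r : ℚ) • basisFun J (r + s) +
        (4 : ℚ) • a := by
  refine ⟨∑ d ∈ Finset.range s, ((4 ^ d * r.choose (d + 1) : ℕ) : ℚ) •
    (((2 : ℚ) ^ highAlpha t r)⁻¹ • ((r + (s - (d + 1))).choose r : ℚ) •
      basisFun J (r + (s - (d + 1)))), sum_mem fun d _ =>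
        natCast_smul_mem (G := weightLattice J _) (smul_basisFun_mem ?_) _, ?_⟩
  · exact (pow_dvd_pow 2 (Nat.le_add_right _ _)).trans
      (two_pow_highAlpha_dvd t r (s - (d + 1)))
  rw [smul_mul_assoc, basisFun_mul, Finset.sum_range_succ', add_comm, Finset.smul_sum, smul_add,
    Finset.smul_sum]
  congr 1
  · simp
  · refine Finset.sum_congr rfl fun d _ => ?_
    simp only [smul_smul]
    push_cast
    ring_nf

/-! ### Powers of the odd integers in terms of the functions `basisFun` -/

/-- The function `j ↦ 2 * j + 1` on `{0, …, J - 1}`. -/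
def oddFun (J : ℕ) : Fin J → ℚ := fun j => 2 * (j : ℕ) + 1

theorem mul_mem_of_closure {R : Type*} [CommRing R] {S₁ S₂ : Set R} {I : AddSubgroup R}
    (h : ∀ g ∈ S₁, ∀ k ∈ S₂, g * k ∈ I) {f g : R}
    (hf : f ∈ AddSubgroup.closure S₁) (hg : g ∈ AddSubgroup.closure S₂) : f * g ∈ I := by
  induction hf using AddSubgroup.closure_induction with
  | mem f hf =>
    induction hg using AddSubgroup.closure_induction with
    | mem g hg => exact h f hf g hg
    | zero => rw [mul_zero]; exact zero_mem _
    | add g g' _ _ h1 h2 => rw [mul_add]; exact add_mem h1 h2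
    | neg g _ h1 => rw [mul_neg]; exact neg_mem h1
  | zero => rw [zero_mul]; exact zero_mem _
  | add f f' _ _ h1 h2 => rw [add_mul]; exact add_mem h1 h2
  | neg f _ h1 => rw [neg_mul]; exact neg_mem h1

theorem sq_mem_of_closure {R : Type*} [CommRing R] {S : Set R} {I : AddSubgroup R}
    (h1 : ∀ g ∈ S, g * g ∈ I) (h2 : ∀ g ∈ S, ∀ k ∈ S, g * k + g * k ∈ I) {f : R}
    (hf : f ∈ AddSubgroup.closure S) : f * f ∈ I := by
  have hd : ∀ f g : R, f ∈ AddSubgroup.closure S → g ∈ AddSubgroup.closure S →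
      f * g + f * g ∈ I := by
    intro f g hf hg
    rw [← add_mul]
    have hf' : f + f ∈ AddSubgroup.closure ((fun g => g + g) '' S) := by
      induction hf using AddSubgroup.closure_induction with
      | mem f hf => exact AddSubgroup.subset_closure ⟨f, hf, rfl⟩
      | zero => rw [add_zero]; exact zero_mem _
      | add f f' _ _ h1 h2 => rw [add_add_add_comm]; exact add_mem h1 h2
      | neg f _ h1 => rw [← neg_add]; exact neg_mem h1
    refine mul_mem_of_closure ?_ hf' hg
    rintro _ ⟨g, hg, rfl⟩ k hk
    rw [add_mul]
    exact h2 g hg k hk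
  induction hf using AddSubgroup.closure_induction with
  | mem f hf => exact h1 f hf
  | zero => rw [mul_zero]; exact zero_mem _
  | add f f' hf hf' h1 h2 =>
    have : (f + f') * (f + f') = f * f + (f * f' + f * f') + f' * f' := by ring
    rw [this]
    exact add_mem (add_mem h1 (hd f f' hf hf')) h2
  | neg f _ h1 => rw [neg_mul_neg]; exact h1

/-- The multiples by `c` of the elements of `G`. -/
def dilate {J : ℕ} (c : ℚ) (G : AddSubgroup (Fin J → ℚ)) : AddSubgroup (Fin J → ℚ) :=
  G.map (DistribSMul.toAddMonoidHom (Fin J → ℚ) c)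

theorem mem_dilate {J : ℕ} {c : ℚ} {G : AddSubgroup (Fin J → ℚ)} {f : Fin J → ℚ} :
    f ∈ dilate c G ↔ ∃ a ∈ G, f = c • a := by
  simp [dilate, AddSubgroup.mem_map, eq_comm]

/-- The group spanned by the `basisFun J r` with `2 ^ i ≤ 2 * r < 2 ^ (i + 1)`. -/
def midLattice (J i : ℕ) : AddSubgroup (Fin J → ℚ) :=
  AddSubgroup.closure (basisFun J '' {r | 2 ^ i ≤ 2 * r ∧ r < 2 ^ i})

theorem midLattice_le (J i : ℕ) : midLattice J i ≤ (baseRing J).toAddSubgroup := by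
  unfold midLattice
  rw [AddSubgroup.closure_le]
  rintro _ ⟨r, _, rfl⟩
  exact basisFun_mem J r

theorem basisFun_mem_midLattice {J i r : ℕ} (h1 : 2 ^ i ≤ 2 * r) (h2 : r < 2 ^ i) :
    basisFun J r ∈ midLattice J i :=
  AddSubgroup.subset_closure ⟨r, ⟨h1, h2⟩, rfl⟩

theorem sq_mem_of_mem_midLattice {J i : ℕ} {s : Fin J → ℚ} (hs : s ∈ midLattice J i) :
    ∃ a ∈ baseRing J, s * s = (2 : ℚ) • a := by
  have : s * s ∈ dilate 2 (baseRing J).toAddSubgroup := by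
    refine sq_mem_of_closure ?_ ?_ hs
    · rintro _ ⟨r, ⟨hr, _⟩, rfl⟩
      obtain ⟨a, ha, h⟩ := basisFun_mul_eq J r r
      obtain ⟨c, hc⟩ := even_choose_self_add_self (r := r) (by
        have : 0 < 2 ^ i := by positivity
        omega)
      rw [mem_dilate]
      refine ⟨(c : ℚ) • basisFun J (r + r) + (2 : ℚ) • a, add_mem
        (natCast_smul_mem (G := (baseRing J).toAddSubgroup) (basisFun_mem J _) _)
        (natCast_smul_mem (G := (baseRing J).toAddSubgroup) ha 2), ?_⟩
      rw [h, hc, smul_add, smul_smul, smul_smul]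
      push_cast
      norm_num
    · rintro _ ⟨r, _, rfl⟩ _ ⟨s, _, rfl⟩
      rw [mem_dilate]
      exact ⟨basisFun J r * basisFun J s, (baseRing J).mul_mem (basisFun_mem J r) (basisFun_mem J s),
        by rw [two_smul]⟩
  simpa [mem_dilate] using this

theorem basisFun_mul_mem_midLattice {J i : ℕ} {s : Fin J → ℚ} (hs : s ∈ midLattice J i) :
    ∃ b ∈ midLattice J (i + 1), ∃ a ∈ baseRing J,
      basisFun J (2 ^ i) * s = b + (2 : ℚ) • a := by
  have : basisFun J (2 ^ i) * s ∈
      midLattice J (i + 1) ⊔ dilate 2 (baseRing J).toAddSubgroup := by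
    refine mul_mem_of_closure (S₁ := {basisFun J (2 ^ i)}) ?_
      (AddSubgroup.subset_closure rfl) hs
    rintro _ rfl _ ⟨r, ⟨_, hr⟩, rfl⟩
    obtain ⟨a, ha, h⟩ := basisFun_mul_eq J (2 ^ i) r
    rw [h]
    refine add_mem (AddSubgroup.mem_sup_left (natCast_smul_mem (basisFun_mem_midLattice ?_ ?_) _))
      (AddSubgroup.mem_sup_right (mem_dilate.2 ⟨(2 : ℚ) • a,
        natCast_smul_mem (G := (baseRing J).toAddSubgroup) ha 2, ?_⟩))
    · rw [pow_succ']; omega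
    · rw [pow_succ']; omega
    · rw [smul_smul]; norm_num
  obtain ⟨b, hb, c, hc, h⟩ := AddSubgroup.mem_sup.1 this
  obtain ⟨a, ha, rfl⟩ := mem_dilate.1 hc
  exact ⟨b, hb, a, ha, h.symm⟩

theorem basisFun_two_pow_sq {J i : ℕ} (hi : 0 < i) :
    ∃ v : ℤ, Odd v ∧ ∃ a ∈ baseRing J,
      basisFun J (2 ^ i) * basisFun J (2 ^ i) =
        (2 * v : ℚ) • basisFun J (2 ^ (i + 1)) + (8 : ℚ) • a := by
  obtain ⟨a, ha, h⟩ := basisFun_mul_self_eq J (r := 2 ^ i) (by positivity)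
  obtain ⟨v, hv, hc⟩ := choose_two_pow_succ i
  refine ⟨v, by exact_mod_cast hv,
    ((2 ^ (i - 1) * (2 ^ i + (2 ^ i - 1)).choose (2 ^ i) : ℕ) : ℚ) •
      basisFun J (2 ^ i + (2 ^ i - 1)) + (2 : ℚ) • a, add_mem
        (natCast_smul_mem (G := (baseRing J).toAddSubgroup) (basisFun_mem J _) _)
        (natCast_smul_mem (G := (baseRing J).toAddSubgroup) ha 2), ?_⟩
  rw [h, hc, ← mul_two, ← pow_succ, smul_add, smul_smul, smul_smul, smul_smul, add_assoc]
  obtain ⟨k, rfl⟩ : ∃ k, i = k + 1 := ⟨i - 1, by omega⟩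
  congr 1
  · push_cast; rfl
  · congr 1
    · congr 1
      simp only [Nat.add_sub_cancel]
      push_cast
      ring
    · norm_num

/-- The expansion of `oddFun J ^ 2 ^ i`, with an error term in `midLattice J i` up to multiples
of `2`. -/
theorem oddFun_pow_two_pow (J i : ℕ) : ∃ u : ℤ, Odd u ∧ ∃ s ∈ midLattice J i, ∃ c ∈ baseRing J,
    oddFun J ^ 2 ^ i = 1 + (u / 2 : ℚ) • basisFun J (2 ^ i) + (s + (2 : ℚ) • c) := by
  have hnat : ∀ (m : ℕ) {f : Fin J → ℚ}, f ∈ baseRing J → (m : ℚ) • f ∈ baseRing J :=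
    fun m f hf => natCast_smul_mem (G := (baseRing J).toAddSubgroup) hf m
  have hint : ∀ (m : ℤ) {f : Fin J → ℚ}, f ∈ baseRing J → (m : ℚ) • f ∈ baseRing J :=
    fun m f hf => intCast_smul_mem (G := (baseRing J).toAddSubgroup) hf m
  rcases Nat.eq_zero_or_pos i with rfl | hi
  · refine ⟨1, odd_one, 0, zero_mem _, 0, zero_mem _, ?_⟩
    ext j
    simp [oddFun, basisFun]
    ring
  induction i, hi using Nat.le_induction with
  | base =>
    refine ⟨1, odd_one, 0, zero_mem _, basisFun J 1, basisFun_mem J 1, ?_⟩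
    ext j
    simp [oddFun, basisFun, Nat.cast_choose_two]
    ring
  | succ i hi ih =>
    obtain ⟨u, hu, s, hs, c, hc, h⟩ := ih
    obtain ⟨v, hv, a, ha, hsq⟩ := basisFun_two_pow_sq (J := J) hi
    obtain ⟨s', hs', a', ha', hm⟩ := basisFun_mul_mem_midLattice hs
    obtain ⟨a'', ha'', hss⟩ := sq_mem_of_mem_midLattice hs
    have hsB : s ∈ baseRing J := midLattice_le J i hs
    have hyB := basisFun_mem J (2 ^ i)
    refine ⟨u ^ 2 * v, (hu.pow).mul hv, (u : ℚ) • basisFun J (2 ^ i) + (u : ℚ) • s',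
      add_mem (intCast_smul_mem (basisFun_mem_midLattice (by rw [pow_succ'])
        (Nat.pow_lt_pow_right (by norm_num) (by omega))) u) (intCast_smul_mem hs' u),
      (s + (2 : ℚ) • c) + ((u ^ 2 : ℤ) : ℚ) • a + (u : ℚ) • a' +
        (u : ℚ) • (basisFun J (2 ^ i) * c) + a'' + (2 : ℚ) • (s * c) + (2 : ℚ) • (c * c),
      ?_, ?_⟩
    · have := hnat 2 hc
      have := hnat 2 (mul_mem hsB hc)
      have := hnat 2 (mul_mem hc hc)
      have := hint (u ^ 2) ha
      have := hint u ha'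
      have := hint u (mul_mem hyB hc)
      simp only [Nat.cast_ofNat] at *
      exact add_mem (add_mem (add_mem (add_mem (add_mem (add_mem (add_mem hsB ‹_›) ‹_›) ‹_›)
        ‹_›) ‹_›) ‹_›) ‹_›
    · rw [show oddFun J ^ 2 ^ (i + 1) = (oddFun J ^ 2 ^ i) ^ 2 by rw [← pow_mul, ← pow_succ], h]
      ext j
      have e1 := congrFun hsq j
      have e2 := congrFun hm j
      have e3 := congrFun hss j
      simp only [Pi.add_apply, Pi.mul_apply, Pi.smul_apply, smul_eq_mul, Pi.pow_apply,
        Pi.one_apply] at *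
      push_cast
      linear_combination (u ^ 2 / 4 : ℚ) * e1 + (u : ℚ) * e2 + e3

/-- Up to multiples of `2`, the function `2 ^ alpha m * (2 * j + 1) ^ m` is an odd multiple of
`basisFun J m`. -/
theorem two_pow_alpha_smul_oddFun_pow (J m : ℕ) : ∃ u : ℤ, Odd u ∧ ∃ a ∈ baseRing J,
    ((2 : ℚ) ^ alpha m) • oddFun J ^ m = (u : ℚ) • basisFun J m + (2 : ℚ) • a := by
  have hnat : ∀ (m : ℕ) {f : Fin J → ℚ}, f ∈ baseRing J → (m : ℚ) • f ∈ baseRing J :=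
    fun m f hf => natCast_smul_mem (G := (baseRing J).toAddSubgroup) hf m
  have hint : ∀ (m : ℤ) {f : Fin J → ℚ}, f ∈ baseRing J → (m : ℚ) • f ∈ baseRing J :=
    fun m f hf => intCast_smul_mem (G := (baseRing J).toAddSubgroup) hf m
  induction m using Nat.strong_induction_on with
  | _ m ih =>
    rcases Nat.eq_zero_or_pos m with rfl | hm
    · exact ⟨1, odd_one, 0, zero_mem _, by simp [basisFun_zero]⟩
    obtain ⟨i, k, hk, rfl⟩ : ∃ i k, k < 2 ^ i ∧ m = k + 2 ^ i := by
      have h1 := Nat.pow_log_le_self 2 hm.ne'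
      have h2 := Nat.lt_pow_succ_log_self (b := 2) (by norm_num) m
      rw [Nat.succ_eq_add_one, pow_succ] at h2
      exact ⟨Nat.log 2 m, m - 2 ^ Nat.log 2 m, by omega, by omega⟩
    obtain ⟨u, hu, a, ha, h⟩ := ih k (by have := Nat.two_pow_pos i; omega)
    obtain ⟨v, hv, s, hs, c, hc, h'⟩ := oddFun_pow_two_pow J i
    obtain ⟨a', ha', hmul⟩ := basisFun_mul_eq J k (2 ^ i)
    have hodd := odd_choose_add_two_pow hk
    have hsB : s ∈ baseRing J := midLattice_le J i hs
    have hα : alpha (k + 2 ^ i) = alpha k + 1 := by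
      have := alpha_two_pow_mul_add i 1 hk
      rw [mul_one, alpha_one] at this
      rw [add_comm, this, add_comm]
    set C := (k + 2 ^ i).choose k
    refine ⟨u * v * C, (hu.mul hv).mul (by exact_mod_cast hodd),
      ((2 * (u * v) : ℤ) : ℚ) • a' + ((u : ℚ) • basisFun J k + (2 : ℚ) • a) * (1 + (s + (2 : ℚ) • c))
        + (v : ℚ) • (a * basisFun J (2 ^ i)), ?_, ?_⟩
    · have h2a := hnat 2 ha
      have h2c := hnat 2 hc
      simp only [Nat.cast_ofNat] at h2a h2c
      exact add_mem (add_mem (hint _ ha') (mul_mem (add_mem (hint _ (basisFun_mem J k)) h2a)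
        (add_mem (one_mem _) (add_mem hsB h2c)))) (hint _ (mul_mem ha (basisFun_mem J _)))
    · rw [hα, pow_add (oddFun J), h']
      ext j
      have e1 := congrFun h j
      have e2 := congrFun hmul j
      simp only [Pi.add_apply, Pi.mul_apply, Pi.smul_apply, smul_eq_mul, Pi.pow_apply,
        Pi.one_apply] at *
      push_cast
      rw [pow_succ]
      linear_combination (2 * (1 + (v / 2 : ℚ) * basisFun J (2 ^ i) j + (s j + 2 * c j))) * e1
        + (u * v : ℚ) * e2

/-! ### The normalized sum over the odd binomial coefficients -/

theorem four_pow_mul_sum_choose (N n : ℕ) (h : n + 1 ≤ 2 * N) (r : ℕ) :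
    4 ^ r * ∑ j ∈ Finset.range N, (n + 1).choose (2 * j + 1) * j.choose r =
      2 ^ n * (n - r).choose r := by
  induction n using Nat.strong_induction_on generalizing r with
  | _ n ih =>
    obtain ⟨K, rfl⟩ : ∃ K, N = K + 1 := ⟨N - 1, by omega⟩
    match n, ih with
    | 0, _ =>
      rw [Finset.sum_range_succ']
      rcases r with _ | r
      · have : ∑ k ∈ Finset.range K, (0 + 1).choose (2 * (k + 1) + 1) * (k + 1).choose 0 = 0 :=
          Finset.sum_eq_zero fun k _ => by rw [Nat.choose_eq_zero_of_lt (by omega), zero_mul]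
        rw [this]; simp
      · have : ∑ k ∈ Finset.range K, (0 + 1).choose (2 * (k + 1) + 1) * (k + 1).choose (r + 1) = 0 :=
          Finset.sum_eq_zero fun k _ => by rw [Nat.choose_eq_zero_of_lt (by omega), zero_mul]
        rw [this]; simp
    | 1, _ =>
      rw [Finset.sum_range_succ']
      have : ∑ k ∈ Finset.range K, (1 + 1).choose (2 * (k + 1) + 1) * (k + 1).choose r = 0 :=
        Finset.sum_eq_zero fun k _ => by rw [Nat.choose_eq_zero_of_lt (by omega), zero_mul]
      rw [this]
      rcases r with _ | r
      · simp
      · have : (1 - (r + 1)).choose (r + 1) = 0 := Nat.choose_eq_zero_of_lt (by omega)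
        rw [this]; simp
    | n + 2, ih =>
      have h1 := ih (n + 1) (by omega) (by omega) r
      have pascal : ∀ j, (n + 2 + 1).choose (2 * (j + 1) + 1) + (n + 1).choose (2 * (j + 1) + 1) =
          2 * (n + 1 + 1).choose (2 * (j + 1) + 1) + (n + 1).choose (2 * j + 1) := by
        intro j
        have e1 : 2 * (j + 1) + 1 = (2 * j + 2) + 1 := by ring
        have e2 : 2 * j + 2 = (2 * j + 1) + 1 := by ring
        rw [e1, Nat.choose_succ_succ (n + 2), Nat.choose_succ_succ (n + 1) (2 * j + 2),
          e2, Nat.choose_succ_succ (n + 1) (2 * j + 1)]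
        ring
      rcases r with _ | r
      · have h0 := ih n (by omega) (by omega) 0
        simp only [Nat.choose_zero_right, mul_one, pow_zero, one_mul] at *
        rw [Finset.sum_range_succ'] at *
        have hs : ∑ k ∈ Finset.range (K + 1), (n + 1).choose (2 * k + 1) = 2 ^ n := by
          rw [Finset.sum_range_succ']; exact h0
        rw [Finset.sum_range_succ, Nat.choose_eq_zero_of_lt (by omega : n + 1 < 2 * K + 1),
          add_zero] at hs
        have hp := Finset.sum_congr (rfl : Finset.range K = Finset.range K) fun j _ => pascal j
        rw [Finset.sum_add_distrib, Finset.sum_add_distrib, ← Finset.mul_sum, hs] at hp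
        simp only [mul_zero, zero_add, Nat.choose_one_right] at *
        rw [pow_succ, pow_succ] at *
        omega
      · have h0 := ih n (by omega) (by omega) (r + 1)
        have h2 := ih n (by omega) (by omega) r
        rw [Finset.sum_range_succ'] at *
        have hs : ∑ k ∈ Finset.range K, (n + 1).choose (2 * k + 1) * k.choose r =
            ∑ k ∈ Finset.range K, (n + 1).choose (2 * (k + 1) + 1) * (k + 1).choose r +
              (n + 1).choose (2 * 0 + 1) * Nat.choose 0 r := by
          rw [← Finset.sum_range_succ' (fun k => (n + 1).choose (2 * k + 1) * k.choose r),
            Finset.sum_range_succ, Nat.choose_eq_zero_of_lt (by omega : n + 1 < 2 * K + 1),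
            zero_mul, add_zero]
        rw [← hs] at h2
        simp only [Nat.choose_zero_succ, mul_zero, add_zero] at *
        have hp := Finset.sum_congr (rfl : Finset.range K = Finset.range K)
          fun j _ => congrArg (· * (j + 1).choose (r + 1)) (pascal j)
        simp only [add_mul, mul_assoc] at hp
        rw [Finset.sum_add_distrib, Finset.sum_add_distrib, ← Finset.mul_sum] at hp
        have hsplit : ∑ j ∈ Finset.range K, (n + 1).choose (2 * j + 1) * (j + 1).choose (r + 1) =
            ∑ j ∈ Finset.range K, (n + 1).choose (2 * j + 1) * j.choose r +
            ∑ j ∈ Finset.range K, (n + 1).choose (2 * j + 1) * j.choose (r + 1) := by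
          rw [← Finset.sum_add_distrib]
          exact Finset.sum_congr rfl fun j _ => by rw [Nat.choose_succ_succ j r, mul_add]
        have hshift : ∑ j ∈ Finset.range K, (n + 1).choose (2 * j + 1) * j.choose (r + 1) =
            ∑ j ∈ Finset.range K, (n + 1).choose (2 * (j + 1) + 1) * (j + 1).choose (r + 1) := by
          have e : ∑ j ∈ Finset.range (K + 1), (n + 1).choose (2 * j + 1) * j.choose (r + 1) =
              ∑ j ∈ Finset.range K, (n + 1).choose (2 * j + 1) * j.choose (r + 1) := by
            rw [Finset.sum_range_succ, Nat.choose_eq_zero_of_lt (by omega : n + 1 < 2 * K + 1),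
              zero_mul, add_zero]
          rw [← e, Finset.sum_range_succ']
          simp
        rw [hsplit, hshift] at hp
        have hpas : (n + 2 - (r + 1)).choose (r + 1) =
            (n + 1 - (r + 1)).choose (r + 1) + (n - r).choose r := by
          rcases le_or_gt (r + 1) (n + 1) with hr | hr
          · obtain ⟨m, hm⟩ := Nat.exists_eq_add_of_le hr
            have e1 : n + 2 - (r + 1) = m + 1 := by omega
            have e2 : n + 1 - (r + 1) = m := by omega
            have e3 : n - r = m := by omega
            rw [e1, e2, e3, Nat.choose_succ_succ, add_comm]
          · rw [Nat.choose_eq_zero_of_lt (by omega), Nat.choose_eq_zero_of_lt (by omega),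
              Nat.choose_eq_zero_of_lt (by omega)]
        rw [hpas]
        have e5 : 4 ^ (r + 1) * (2 * ∑ i ∈ Finset.range K,
            (n + 1 + 1).choose (2 * (i + 1) + 1) * (i + 1).choose (r + 1)) =
            2 * (2 ^ (n + 1) * (n + 1 - (r + 1)).choose (r + 1)) := by
          rw [← h1]; ring
        have e6 : 4 ^ (r + 1) * ∑ j ∈ Finset.range K, (n + 1).choose (2 * j + 1) * j.choose r =
            4 * (2 ^ n * (n - r).choose r) := by rw [← h2]; ring
        rw [Nat.add_right_cancel (hp.trans (add_assoc _ _ _).symm), mul_add, e5, e6]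
        ring

/-- The linear functional `f ↦ 2 ^ (1 - n) * ∑ choose n (2 * j + 1) * f j`. -/
def oddSum (n : ℕ) : (Fin ((n + 1) / 2) → ℚ) →ₗ[ℚ] ℚ where
  toFun f := ((2 : ℚ) ^ (n - 1))⁻¹ * ∑ j : Fin ((n + 1) / 2), (n.choose (2 * (j : ℕ) + 1) : ℚ) * f j
  map_add' f g := by
    simp only [Pi.add_apply, mul_add, Finset.sum_add_distrib]
  map_smul' c f := by
    simp only [Pi.smul_apply, smul_eq_mul, RingHom.id_apply]
    rw [mul_left_comm, Finset.mul_sum (a := c)]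
    congr 1
    exact Finset.sum_congr rfl fun j _ => by ring

theorem oddSum_basisFun {n : ℕ} (hn : 0 < n) (r : ℕ) :
    oddSum n (basisFun _ r) = ((n - 1 - r).choose r : ℚ) := by
  obtain ⟨m, rfl⟩ : ∃ m, n = m + 1 := ⟨n - 1, by omega⟩
  have h := congrArg (Nat.cast : ℕ → ℚ)
    (four_pow_mul_sum_choose ((m + 1 + 1) / 2) m (by omega) r)
  push_cast at h
  rw [Nat.add_sub_cancel]
  simp only [oddSum, LinearMap.coe_mk, AddHom.coe_mk, basisFun, Nat.add_sub_cancel]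
  rw [inv_mul_eq_iff_eq_mul₀ (by positivity), ← h, Finset.sum_range, Finset.mul_sum]
  exact Finset.sum_congr rfl fun j _ => by ring

theorem T_eq_sum (n : ℕ) (k : ℤ) :
    T n k = ∑ j : Fin ((n + 1) / 2), (n.choose (2 * (j : ℕ) + 1) : ℚ) *
      ((2 * (j : ℕ) + 1 : ℕ) : ℚ) ^ k := by
  unfold T
  rw [Finset.sum_fin_eq_sum_range]
  symm
  refine Finset.sum_nbij' (fun j => 2 * j + 1) (fun i => i / 2) ?_ ?_ ?_ ?_ ?_
  · intro j hj
    rw [Finset.mem_range] at hj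
    rw [Finset.mem_filter, Finset.mem_range]
    exact ⟨by omega, ⟨j, rfl⟩⟩
  · intro i hi
    rw [Finset.mem_filter, Finset.mem_range] at hi
    obtain ⟨hi, c, rfl⟩ := hi
    rw [Finset.mem_range]
    omega
  · intro j _
    omega
  · intro i hi
    rw [Finset.mem_filter, Finset.mem_range] at hi
    obtain ⟨hi, c, rfl⟩ := hi
    omega
  · intro j hj
    rw [Finset.mem_range] at hj
    rw [dif_pos hj]

theorem T_natCast (n k : ℕ) : T n k = 2 ^ (n - 1) * oddSum n (oddFun _ ^ k) := by
  rw [T_eq_sum]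
  simp only [oddSum, LinearMap.coe_mk, AddHom.coe_mk]
  rw [mul_inv_cancel_left₀ (by positivity)]
  refine Finset.sum_congr rfl fun j _ => ?_
  rw [zpow_natCast]
  simp [oddFun]

theorem oddSum_baseRing {n : ℕ} (hn : 0 < n) {f : Fin ((n + 1) / 2) → ℚ} (hf : f ∈ baseRing _) :
    ∃ z : ℤ, oddSum n f = z := by
  refine baseRing_induction (P := fun f => ∃ z : ℤ, oddSum n f = z) ?_ ?_ ?_ ?_ hf
  · intro r
    exact ⟨(n - 1 - r).choose r, by rw [oddSum_basisFun hn]; simp⟩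
  · exact ⟨0, by simp⟩
  · rintro f g ⟨a, ha⟩ ⟨b, hb⟩
    exact ⟨a + b, by rw [map_add, ha, hb]; push_cast; ring⟩
  · rintro f ⟨a, ha⟩
    exact ⟨-a, by rw [map_neg, ha]; push_cast; ring⟩

theorem oddSum_highRing {e t n : ℕ} (hte : t < e) (hn : 2 ^ e < n) (hn' : n < 2 ^ e + 2 ^ (t + 1))
    {f : Fin ((n + 1) / 2) → ℚ} (hf : f ∈ highRing _ t) :
    ∃ z : ℤ, 2 * oddSum n f = z := by
  refine highRing_induction (P := fun f => ∃ z : ℤ, 2 * oddSum n f = z) ?_ ?_ ?_ ?_ hf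
  · intro r
    obtain ⟨c, hc⟩ := two_pow_highAlpha_dvd_two_mul_choose hte hn' hn r
    refine ⟨c, ?_⟩
    have hc' := congrArg (Nat.cast : ℕ → ℚ) hc
    push_cast at hc'
    rw [map_smul, oddSum_basisFun (Nat.zero_lt_of_lt hn), smul_eq_mul, mul_left_comm, hc',
      inv_mul_cancel_left₀ (by positivity)]
    simp
  · exact ⟨0, by simp⟩
  · rintro f g ⟨a, ha⟩ ⟨b, hb⟩
    exact ⟨a + b, by rw [map_add, mul_add, ha, hb]; push_cast; ring⟩
  · rintro f ⟨a, ha⟩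
    exact ⟨-a, by rw [map_neg, mul_neg, ha]; push_cast; ring⟩

/-- Adding the digit `2 ^ w` with `2 ^ (w + 1) ∣ n` makes the functional even on `baseRing`. -/
theorem oddSum_basisFun_mul_baseRing {n w : ℕ} (hn : 0 < n) (hw : 2 ^ (w + 1) ∣ n)
    {f : Fin ((n + 1) / 2) → ℚ} (hf : f ∈ baseRing _) :
    ∃ z : ℤ, oddSum n (basisFun _ (2 ^ w) * f) = 2 * z := by
  refine baseRing_induction (P := fun f => ∃ z : ℤ, oddSum n (basisFun _ (2 ^ w) * f) = 2 * z)
    ?_ ?_ ?_ ?_ hf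
  · intro r
    obtain ⟨a, ha, h⟩ := basisFun_mul_eq ((n + 1) / 2) (2 ^ w) r
    obtain ⟨z, hz⟩ := oddSum_baseRing hn ha
    have : 2 ∣ (2 ^ w + r).choose (2 ^ w) * (n - 1 - (2 ^ w + r)).choose (2 ^ w + r) := by
      by_cases hr : (2 ^ w + r) % 2 ^ (w + 1) = 0
      · apply dvd_mul_of_dvd_left
        have h1 := padicValNat_choose_add_alpha (2 ^ w) r
        have h2 := alpha_div_add_mod (w + 1) (2 ^ w + r)
        have h3 := alpha_div_add_mod (w + 1) r
        have hr2 : r % 2 ^ (w + 1) = 2 ^ w := by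
          have hQ : 2 ^ (w + 1) = 2 * 2 ^ w := pow_succ' _ _
          have hlt : r % 2 ^ w < 2 ^ w := Nat.mod_lt _ (by positivity)
          rw [Nat.add_mod, Nat.mod_eq_of_lt (a := 2 ^ w) (by omega)] at hr
          rcases mod_two_pow_succ_eq r w with hb | hb <;> rw [hb] at hr ⊢
          · rw [Nat.mod_eq_of_lt (by omega)] at hr
            omega
          · rw [← add_assoc, ← two_mul, ← hQ, Nat.add_mod_left, Nat.mod_eq_of_lt (by omega)] at hr
            omega
        rw [hr, alpha_zero] at h2
        rw [hr2, alpha_two_pow] at h3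
        rw [alpha_two_pow] at h1
        have h4 : alpha ((2 ^ w + r) / 2 ^ (w + 1)) ≤ alpha (r / 2 ^ (w + 1)) + 1 := by
          have : (2 ^ w + r) / 2 ^ (w + 1) = r / 2 ^ (w + 1) + 1 := by
            have e1 := Nat.div_add_mod r (2 ^ (w + 1))
            rw [hr2] at e1
            have e2 : 2 ^ w + r = 2 ^ (w + 1) * (r / 2 ^ (w + 1) + 1) := by
              rw [mul_add, mul_one]
              have : 2 ^ (w + 1) = 2 * 2 ^ w := pow_succ' _ _
              omega
            rw [e2, Nat.mul_div_cancel_left _ (by positivity)]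
          rw [this]
          exact alpha_succ_le _
        have := two_pow_dvd_of_le_padicValNat (k := 1) (m := (2 ^ w + r).choose (2 ^ w)) (by omega)
        simpa using this
      · exact dvd_mul_of_dvd_right (two_dvd_choose_of_mod_ne_zero hn hw hr) _
    obtain ⟨c, hc⟩ := this
    refine ⟨c + 2 * z, ?_⟩
    have hc' := congrArg (Nat.cast : ℕ → ℚ) hc
    push_cast at hc'
    rw [h, map_add, map_smul, map_smul, oddSum_basisFun hn, hz, smul_eq_mul, smul_eq_mul, hc']
    push_cast
    ring
  · exact ⟨0, by simp⟩
  · rintro f g ⟨a, ha⟩ ⟨b, hb⟩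
    exact ⟨a + b, by rw [mul_add, map_add, ha, hb]; push_cast; ring⟩
  · rintro f ⟨a, ha⟩
    exact ⟨-a, by rw [mul_neg, map_neg, ha]; push_cast; ring⟩

theorem oddSum_basisFun_mul_highRing {e t n w : ℕ} (hte : t < e) (hn : 2 ^ e < n)
    (hn' : n < 2 ^ e + 2 ^ (t + 1)) (hwt : w < t) (hw : 2 ^ (w + 1) ∣ n)
    {f : Fin ((n + 1) / 2) → ℚ} (hf : f ∈ highRing _ t) :
    ∃ z : ℤ, oddSum n (f * basisFun _ (2 ^ w)) = z := by
  have hn0 : 0 < n := Nat.zero_lt_of_lt hn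
  refine highRing_induction (P := fun f => ∃ z : ℤ, oddSum n (f * basisFun _ (2 ^ w)) = z)
    ?_ ?_ ?_ ?_ hf
  · intro r
    obtain ⟨a, ha, h⟩ := gen_mul_basisFun_eq ((n + 1) / 2) t r (2 ^ w)
    obtain ⟨z, hz⟩ := oddSum_highRing hte hn hn' ha
    have : 2 ^ highAlpha t r ∣
        (r + 2 ^ w).choose r * (n - 1 - (r + 2 ^ w)).choose (r + 2 ^ w) := by
      have hh := highAlpha_add_le t r (2 ^ w)
      rw [highAlpha_of_lt (Nat.pow_lt_pow_right (by norm_num) hwt), add_zero] at hh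
      rcases mod_two_pow_succ_eq (r + 2 ^ w) w with hb | hb
      · -- the digit `w` of `r` is `1`, so that the addition has a carry there
        have h1 := padicValNat_choose_add_alpha r (2 ^ w)
        have h2 := alpha_div_add_mod t r
        have h3 := alpha_div_add_mod t (r + 2 ^ w)
        have hr : r % 2 ^ (w + 1) = 2 ^ w + r % 2 ^ w := by
          rcases mod_two_pow_succ_eq r w with hb' | hb'
          · have hlt : r % 2 ^ w < 2 ^ w := Nat.mod_lt _ (by positivity)
            rw [Nat.add_mod_right, Nat.add_mod, hb', Nat.mod_eq_of_lt (a := 2 ^ w)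
              (Nat.pow_lt_pow_right (by norm_num) (by omega)),
              Nat.mod_eq_of_lt (by rw [pow_succ']; omega)] at hb
            have := Nat.two_pow_pos w
            omega
          · exact hb'
        have h4 : alpha ((r + 2 ^ w) % 2 ^ t) ≤ alpha (r % 2 ^ t) := by
          have e1 : r % 2 ^ t = (r % 2 ^ t - 2 ^ w) + 2 ^ w := by
            have : 2 ^ w ≤ r % 2 ^ t := by
              have h5 : r % 2 ^ t % 2 ^ (w + 1) = r % 2 ^ (w + 1) :=
                Nat.mod_mod_of_dvd _ (pow_dvd_pow 2 (by omega))
              have := Nat.mod_le (r % 2 ^ t) (2 ^ (w + 1))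
              omega
            omega
          set s := r % 2 ^ t - 2 ^ w with hs
          have e2 : s % 2 ^ (w + 1) = r % 2 ^ w := by
            have h5 : r % 2 ^ t % 2 ^ (w + 1) = r % 2 ^ (w + 1) :=
              Nat.mod_mod_of_dvd _ (pow_dvd_pow 2 (by omega))
            rw [e1, hr, add_comm s] at h5
            have hQ : 2 ^ (w + 1) = 2 * 2 ^ w := pow_succ' _ _
            have hlt : r % 2 ^ w < 2 ^ w := Nat.mod_lt _ (by positivity)
            have h6 : 2 ^ w + s ≡ 2 ^ w + r % 2 ^ w [MOD 2 ^ (w + 1)] := by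
              unfold Nat.ModEq
              rw [h5, Nat.mod_eq_of_lt (a := 2 ^ w + r % 2 ^ w) (by omega)]
            have h7 := Nat.ModEq.add_left_cancel' _ h6
            unfold Nat.ModEq at h7
            rw [h7, Nat.mod_eq_of_lt (a := r % 2 ^ w) (by omega)]
          have e3 : alpha (s + 2 ^ w) = alpha s + 1 := by
            have hlt : r % 2 ^ w < 2 ^ w := Nat.mod_lt _ (by positivity)
            have hd := Nat.div_add_mod s (2 ^ (w + 1))
            rw [e2] at hd
            have hsum := alpha_two_pow_mul_add w 1 hlt
            rw [mul_one, alpha_one] at hsum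
            rw [← hd, alpha_two_pow_mul_add (w + 1) _ (by rw [pow_succ']; omega), add_assoc,
              alpha_two_pow_mul_add (w + 1) _ (by rw [pow_succ']; omega), add_comm _ (2 ^ w), hsum]
            ring
          have e4 : (r + 2 ^ w) % 2 ^ t = (s + 2 ^ (w + 1)) % 2 ^ t := by
            rw [← Nat.mod_add_mod, e1, pow_succ, mul_two, ← add_assoc]
          rw [e4, e1, e3]
          refine (alpha_mod_le _ _).trans ((alpha_add_le _ _).trans ?_)
          rw [alpha_two_pow]
        have h5 := two_pow_highAlpha_dvd_two_mul_choose hte hn' hn (r + 2 ^ w)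
        unfold highAlpha at *
        rw [alpha_two_pow] at h1
        have h6 : 2 ^ padicValNat 2 ((r + 2 ^ w).choose r) ∣ (r + 2 ^ w).choose r :=
          pow_padicValNat_dvd
        apply Nat.dvd_of_mul_dvd_mul_left (k := 2) (by norm_num)
        calc 2 * 2 ^ alpha (r / 2 ^ t) ∣ 2 ^ padicValNat 2 ((r + 2 ^ w).choose r) *
              2 ^ alpha ((r + 2 ^ w) / 2 ^ t) := by
              rw [← pow_add, ← pow_succ']; exact pow_dvd_pow 2 (by omega)
          _ ∣ (r + 2 ^ w).choose r * (2 * (n - 1 - (r + 2 ^ w)).choose (r + 2 ^ w)) :=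
              mul_dvd_mul h6 h5
          _ = _ := by ring
      · have h1 := two_pow_highAlpha_dvd_choose hte hn' hn hwt hw hb
        have h2 := two_pow_highAlpha_dvd t r (2 ^ w)
        rw [highAlpha_of_lt (r := 2 ^ w) (Nat.pow_lt_pow_right (by norm_num) hwt), add_zero] at h2
        rw [mul_comm]
        exact h2.trans (mul_dvd_mul_right h1 _)
    obtain ⟨c, hc⟩ := this
    refine ⟨c + 2 * z, ?_⟩
    have hc' := congrArg (Nat.cast : ℕ → ℚ) hc
    push_cast at hc'
    rw [h, map_add, map_smul, map_smul, map_smul, oddSum_basisFun hn0, smul_eq_mul, smul_eq_mul,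
      smul_eq_mul, hc', inv_mul_cancel_left₀ (by positivity)]
    push_cast
    linear_combination 2 * hz
  · exact ⟨0, by simp⟩
  · rintro f g ⟨a, ha⟩ ⟨b, hb⟩
    exact ⟨a + b, by rw [add_mul, map_add, ha, hb]; push_cast; ring⟩
  · rintro f ⟨a, ha⟩
    exact ⟨-a, by rw [neg_mul, map_neg, ha]; push_cast; ring⟩

/-! ### Congruences for the powers of the odd integers -/

theorem subring_smul_mem {J : ℕ} (S : Subring (Fin J → ℚ)) {f : Fin J → ℚ} (hf : f ∈ S) (m : ℤ) :
    (m : ℚ) • f ∈ S :=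
  intCast_smul_mem (G := S.toAddSubgroup) hf m

theorem half_smul_basisFun_mem {J t r : ℕ} (h : 2 ^ t ≤ r) (u : ℤ) :
    (u / 2 : ℚ) • basisFun J r ∈ highRing J t := by
  have := subring_smul_mem _ (half_basisFun_mem (J := J) h) u
  rwa [smul_smul, ← div_eq_mul_inv] at this

theorem half_smul_basisFun_sq {J t i : ℕ} (hti : t ≤ i) (hi : 0 < i) (hJ : J ≤ 2 ^ (i + 1))
    (u : ℤ) : ∃ a ∈ highRing J t, ((u / 2 : ℚ) • basisFun J (2 ^ i)) *
      ((u / 2 : ℚ) • basisFun J (2 ^ i)) = (4 : ℚ) • a := by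
  obtain ⟨a, ha, h⟩ := basisFun_mul_self_eq J (r := 2 ^ i) (by positivity)
  have hle : 2 ^ t ≤ 2 ^ i + (2 ^ i - 1) :=
    (Nat.pow_le_pow_right (by norm_num) hti).trans (Nat.le_add_right _ _)
  have hm := half_basisFun_mem (J := J) hle
  obtain ⟨k, rfl⟩ : ∃ k, i = k + 1 := ⟨i - 1, by omega⟩
  refine ⟨((u ^ 2 : ℤ) : ℚ) • (((2 ^ k * ((2 ^ (k + 1) + (2 ^ (k + 1) - 1)).choose (2 ^ (k + 1)))
    : ℕ) : ℤ) : ℚ) • ((2⁻¹ : ℚ) • basisFun J (2 ^ (k + 1) + (2 ^ (k + 1) - 1))) +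
      ((u ^ 2 : ℤ) : ℚ) • a, add_mem (subring_smul_mem _ (subring_smul_mem _ hm _) _)
        (subring_smul_mem _ (baseRing_le J t ha) _), ?_⟩
  rw [smul_mul_smul_comm, h, basisFun_eq_zero (r := 2 ^ (k + 1) + 2 ^ (k + 1))
    (by rw [← mul_two, ← pow_succ]; exact hJ)]
  ext j
  simp only [Pi.add_apply, Pi.smul_apply, smul_eq_mul, Pi.zero_apply]
  push_cast
  ring

theorem midLattice_sq {J t i : ℕ} (hti : t ≤ i) {s c : Fin J → ℚ} (hs : s ∈ midLattice J i)
    (hc : c ∈ baseRing J) :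
    ∃ a ∈ highRing J t, (s + (2 : ℚ) • c) * (s + (2 : ℚ) • c) = (4 : ℚ) • a := by
  have hpow : 2 ^ t ≤ 2 ^ i := Nat.pow_le_pow_right (by norm_num) hti
  have hss : s * s ∈ dilate 4 (highRing J t).toAddSubgroup := by
    refine sq_mem_of_closure ?_ ?_ hs
    · rintro _ ⟨r, ⟨hr, _⟩, rfl⟩
      obtain ⟨a, ha, h⟩ := basisFun_mul_eq J r r
      have hm := half_basisFun_mem (J := J) (t := t) (r := r + r) (by omega)
      obtain ⟨c, hc⟩ := even_choose_self_add_self (r := r) (by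
        have : 0 < 2 ^ i := by positivity
        omega)
      rw [mem_dilate]
      refine ⟨((c : ℤ) : ℚ) • ((2⁻¹ : ℚ) • basisFun J (r + r)) + a, (highRing J t).add_mem
        (subring_smul_mem _ hm _) (baseRing_le J t ha), ?_⟩
      rw [h, hc]
      ext j
      simp only [Pi.add_apply, Pi.smul_apply, smul_eq_mul]
      push_cast
      ring
    · rintro _ ⟨r, ⟨hr, _⟩, rfl⟩ _ ⟨q, ⟨hq, _⟩, rfl⟩
      obtain ⟨a, ha, h⟩ := basisFun_mul_eq J r q
      have hm := half_basisFun_mem (J := J) (t := t) (r := r + q) (by omega)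
      rw [mem_dilate]
      refine ⟨((((r + q).choose r : ℕ) : ℤ) : ℚ) • ((2⁻¹ : ℚ) • basisFun J (r + q)) +
        ((2 : ℤ) : ℚ) • a, (highRing J t).add_mem (subring_smul_mem _ hm _)
          (subring_smul_mem _ (baseRing_le J t ha) _), ?_⟩
      rw [h]
      ext j
      simp only [Pi.add_apply, Pi.smul_apply, smul_eq_mul]
      push_cast
      ring
  obtain ⟨a, ha, h⟩ := mem_dilate.1 hss
  have hsD := baseRing_le J t (midLattice_le J i hs)
  have hcD := baseRing_le J t hc
  refine ⟨a + s * c + c * c, add_mem (add_mem ha (mul_mem hsD hcD)) (mul_mem hcD hcD), ?_⟩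
  ext j
  have e1 := congrFun h j
  simp only [Pi.add_apply, Pi.mul_apply, Pi.smul_apply, smul_eq_mul] at *
  linear_combination e1

theorem midLattice_half {J t i : ℕ} (hti : t < i) {s : Fin J → ℚ} (hs : s ∈ midLattice J i) :
    ∃ a ∈ highRing J t, s = (2 : ℚ) • a := by
  have : midLattice J i ≤ dilate 2 (highRing J t).toAddSubgroup := by
    unfold midLattice
    rw [AddSubgroup.closure_le]
    rintro _ ⟨r, ⟨hr, _⟩, rfl⟩
    have hpow : 2 ^ (t + 1) ≤ 2 ^ i := Nat.pow_le_pow_right (by norm_num) hti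
    rw [pow_succ'] at hpow
    refine mem_dilate.2 ⟨_, half_basisFun_mem (t := t) (r := r) (by omega), ?_⟩
    rw [smul_smul]
    norm_num
  simpa [mem_dilate] using this hs

/-- If `1 + Y + b` has `Y ^ 2` and `b ^ 2` divisible by `4`, its iterated squares are `1` plus
powers of `2` times `Y + b`, up to a multiple of `Y * b`. -/
theorem pow_two_pow_sub_one {J : ℕ} {D : Subring (Fin J → ℚ)} {Y b f g : Fin J → ℚ} (hY : Y ∈ D)
    (hb : b ∈ D) (hf : f ∈ D) (hg : g ∈ D) (hYY : Y * Y = (4 : ℚ) • f)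
    (hbb : b * b = (4 : ℚ) • g) (d : ℕ) :
    ∃ ε : ℤ, ∃ a ∈ D, (1 + Y + b) ^ 2 ^ d - 1 =
      ((2 : ℚ) ^ d) • (Y + b + (ε : ℚ) • (Y * b)) + ((2 : ℚ) ^ (d + 1)) • a := by
  rcases Nat.eq_zero_or_pos d with rfl | hd
  · refine ⟨0, 0, zero_mem _, ?_⟩
    ext j
    simp
    ring
  induction d, hd using Nat.le_induction with
  | base =>
    refine ⟨1, f + g, add_mem hf hg, ?_⟩
    ext j
    have e1 := congrFun hYY j
    have e2 := congrFun hbb j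
    simp only [Pi.add_apply, Pi.mul_apply, Pi.smul_apply, smul_eq_mul, Pi.pow_apply,
      Pi.sub_apply, Pi.one_apply] at *
    push_cast
    linear_combination e1 + e2
  | succ d hd ih =>
    obtain ⟨ε, a, ha, h⟩ := ih
    obtain ⟨k, rfl⟩ : ∃ k, d = k + 1 := ⟨d - 1, by omega⟩
    have hYb := mul_mem hY hb
    have hV : Y + b + (ε : ℚ) • (Y * b) ∈ D :=
      add_mem (add_mem hY hb) (subring_smul_mem D hYb ε)
    set V := Y + b + (ε : ℚ) • (Y * b) with hVdef
    have hv : ∃ v ∈ D, V * V = (2 : ℚ) • v := by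
      refine ⟨((2 : ℤ) : ℚ) • f + ((2 : ℤ) : ℚ) • g + Y * b + ((4 * ε : ℤ) : ℚ) • (f * b + Y * g)
        + ((2 * ε ^ 2 : ℤ) : ℚ) • (f * (b * b)), ?_, ?_⟩
      · exact add_mem (add_mem (add_mem (add_mem (subring_smul_mem D hf _)
          (subring_smul_mem D hg _)) hYb) (subring_smul_mem D (add_mem (mul_mem hf hb)
          (mul_mem hY hg)) _)) (subring_smul_mem D (mul_mem hf (mul_mem hb hb)) _)
      · ext j
        have e1 := congrFun hYY j
        have e2 := congrFun hbb j
        simp only [hVdef, Pi.add_apply, Pi.mul_apply, Pi.smul_apply, smul_eq_mul] at *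
        push_cast
        linear_combination (1 + 2 * ε * b j + ε ^ 2 * b j ^ 2) * e1 + (1 + 2 * ε * Y j) * e2
    obtain ⟨v, hvD, hv⟩ := hv
    refine ⟨ε, a + ((2 ^ k : ℤ) : ℚ) • (v + ((2 : ℤ) : ℚ) • (V * a) + ((2 : ℤ) : ℚ) • (a * a)),
      add_mem ha (subring_smul_mem D (add_mem (add_mem hvD (subring_smul_mem D (mul_mem hV ha) _))
        (subring_smul_mem D (mul_mem ha ha) _)) _), ?_⟩
    have hsq : (1 + Y + b) ^ 2 ^ (k + 1 + 1) - 1 =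
        (2 : ℚ) • ((1 + Y + b) ^ 2 ^ (k + 1) - 1) +
          ((1 + Y + b) ^ 2 ^ (k + 1) - 1) * ((1 + Y + b) ^ 2 ^ (k + 1) - 1) := by
      rw [pow_succ 2 (k + 1), pow_mul, two_smul]
      ring
    rw [hsq, h, ← hVdef]
    ext j
    have e1 := congrFun hv j
    simp only [Pi.add_apply, Pi.mul_apply, Pi.smul_apply, smul_eq_mul] at *
    push_cast
    linear_combination ((2 : ℚ) ^ (k + 1)) ^ 2 * e1

/-- The expansion of `x ^ (2 ^ t * κ) * (x ^ 2 ^ (e - 1 + d) - 1)` for `x = oddFun J`. -/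
theorem oddFun_pow_mul_expansion {J e t : ℕ} (he : 2 ≤ e) (hte : t < e)
    (hJ : J ≤ 2 ^ (e - 1) + 2 ^ t) (κ d : ℕ) :
    ∃ u : ℤ, Odd u ∧ ∃ c : ℤ, (c = 0 ∨ t + 1 = e ∨ Odd κ) ∧ ∃ σ ∈ midLattice J t,
      ∃ β ∈ baseRing J, ∃ a ∈ highRing J t,
        oddFun J ^ (2 ^ t * κ) * (oddFun J ^ 2 ^ (e - 1 + d) - 1) =
          ((2 : ℚ) ^ d) • ((u / 2 : ℚ) • basisFun J (2 ^ (e - 1)) +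
            (c : ℚ) • (σ * ((u / 2 : ℚ) • basisFun J (2 ^ (e - 1)))) + β) +
              ((2 : ℚ) ^ (d + 1)) • a := by
  have hpow : 2 ^ t ≤ 2 ^ (e - 1) := Nat.pow_le_pow_right (by norm_num) (by omega)
  have he1 : 2 ^ (e - 1 + 1) = 2 * 2 ^ (e - 1) := pow_succ' _ _
  obtain ⟨u, hu, s, hs, c, hc, hX⟩ := oddFun_pow_two_pow J (e - 1)
  have hYD := half_smul_basisFun_mem (J := J) hpow u
  obtain ⟨f, hf, hYY⟩ := half_smul_basisFun_sq (J := J) (t := t) (i := e - 1) (by omega) (by omega)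
    (by omega) u
  obtain ⟨g, hg, hbb⟩ := midLattice_sq (t := t) (i := e - 1) (by omega) hs hc
  have hbB : s + (2 : ℚ) • c ∈ baseRing J :=
    add_mem (midLattice_le J _ hs) (by simpa using subring_smul_mem _ hc 2)
  have hbD := baseRing_le J t hbB
  set Y := (u / 2 : ℚ) • basisFun J (2 ^ (e - 1)) with hYdef
  obtain ⟨ε, a, ha, hW⟩ := pow_two_pow_sub_one hYD hbD hf hg hYY hbb d
  rw [← hX, ← pow_mul, ← pow_add] at hW
  obtain ⟨ut, hut, st, hst, ct, hct, hXt⟩ := oddFun_pow_two_pow J t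
  have hstB := midLattice_le J t hst
  have hstD := baseRing_le J t hstB
  have hctD := baseRing_le J t hct
  have hXtD : oddFun J ^ 2 ^ t ∈ highRing J t := by
    rw [hXt]
    exact add_mem (add_mem (one_mem _) (half_smul_basisFun_mem le_rfl ut))
      (add_mem hstD (by simpa using subring_smul_mem _ hctD 2))
  rw [pow_mul]
  refine ⟨u, hu, ?_⟩
  rcases Nat.eq_or_lt_of_le (Nat.succ_le_of_lt hte) with hlast | hlast
  · -- `t = e - 1`
    have hte1 : e - 1 = t := by omega
    have key : ∀ κ : ℕ, ∃ a ∈ highRing J t, (oddFun J ^ 2 ^ t) ^ κ *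
        (Y + (s + (2 : ℚ) • c) + (ε : ℚ) • (Y * (s + (2 : ℚ) • c))) =
          (Y + (s + (2 : ℚ) • c) + (ε : ℚ) • (Y * (s + (2 : ℚ) • c))) + (2 : ℚ) • a := by
      rw [hte1] at hX
      intro κ
      set b := s + (2 : ℚ) • c
      induction κ with
      | zero => exact ⟨0, zero_mem _, by simp⟩
      | succ κ ih =>
        obtain ⟨a', ha', h'⟩ := ih
        refine ⟨((2 : ℤ) : ℚ) • f + ((2 : ℤ) : ℚ) • g + Y * b +
          ((2 * ε : ℤ) : ℚ) • (f * b + g * Y) + oddFun J ^ 2 ^ t * a', ?_, ?_⟩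
        · exact add_mem (add_mem (add_mem (add_mem (subring_smul_mem _ hf _)
            (subring_smul_mem _ hg _)) (mul_mem hYD hbD)) (subring_smul_mem _
              (add_mem (mul_mem hf hbD) (mul_mem hg hYD)) _)) (mul_mem hXtD ha')
        · rw [pow_succ', mul_assoc, h', mul_add]
          ext j
          have e1 := congrFun hYY j
          have e2 := congrFun hbb j
          have e3 := congrFun hX j
          simp only [Pi.add_apply, Pi.mul_apply, Pi.smul_apply, smul_eq_mul, Pi.one_apply] at *
          push_cast
          linear_combination (Y j + b j + ε * (Y j * b j)) * e3 + (1 + ε * b j) * e1 +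
            (1 + ε * Y j) * e2
    obtain ⟨a', ha', h'⟩ := key κ
    have hs' : s ∈ midLattice J t := hte1 ▸ hs
    refine ⟨ε, Or.inr (Or.inl hlast), s, hs', s + (2 : ℚ) • c, hbB,
      a' + (oddFun J ^ 2 ^ t) ^ κ * a + (ε : ℚ) • (c * Y),
      add_mem (add_mem ha' (mul_mem (pow_mem hXtD κ) ha))
        (subring_smul_mem _ (mul_mem (baseRing_le J t hc) hYD) _), ?_⟩
    rw [hW, ← hYdef]
    ext j
    have e1 := congrFun h' j
    simp only [Pi.add_apply, Pi.mul_apply, Pi.smul_apply, smul_eq_mul, Pi.pow_apply] at *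
    linear_combination (2 : ℚ) ^ d * e1
  · -- `t < e - 1`
    obtain ⟨s', hs', hss'⟩ := midLattice_half (t := t) (i := e - 1) (by omega) hs
    have hYtY : ∃ a ∈ highRing J t, ((ut / 2 : ℚ) • basisFun J (2 ^ t)) * Y = (2 : ℚ) • a := by
      have hω : ∀ i, t ≤ i → highAlpha t (2 ^ i) = 1 := by
        intro i hi
        rw [highAlpha, Nat.pow_div hi (by norm_num), alpha_two_pow]
      obtain ⟨a, ha, h⟩ := gen_mul_gen_eq (J := J) (isWeight_highAlpha t) (2 ^ t) (2 ^ (e - 1))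
      rw [hω t le_rfl, hω (e - 1) (by omega), basisFun_eq_zero (r := 2 ^ t + 2 ^ (e - 1))
        (by omega)] at h
      refine ⟨((ut * u : ℤ) : ℚ) • a, subring_smul_mem (highRing J t) ha _, ?_⟩
      ext j
      have e1 := congrFun h j
      simp only [hYdef, Pi.add_apply, Pi.mul_apply, Pi.smul_apply, smul_eq_mul,
        Pi.zero_apply] at *
      push_cast
      linear_combination (ut * u : ℚ) * e1
    obtain ⟨q, hq, hYtY⟩ := hYtY
    obtain ⟨r, hr, hbtbt⟩ := sq_mem_of_mem_midLattice hst
    have hrD := baseRing_le J t hr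
    have key : ∀ κ : ℕ, ∃ a ∈ highRing J t, (oddFun J ^ 2 ^ t) ^ κ * Y =
        Y + (κ : ℚ) • (st * Y) + (2 : ℚ) • a := by
      intro κ
      induction κ with
      | zero => exact ⟨0, zero_mem _, by simp⟩
      | succ κ ih =>
        obtain ⟨a', ha', h'⟩ := ih
        refine ⟨q + ct * Y + ((κ : ℤ) : ℚ) • (q * st + r * Y + ct * (st * Y)) +
          oddFun J ^ 2 ^ t * a', ?_, ?_⟩
        · exact add_mem (add_mem (add_mem hq (mul_mem hctD hYD)) (subring_smul_mem _
            (add_mem (add_mem (mul_mem hq hstD) (mul_mem hrD hYD))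
              (mul_mem hctD (mul_mem hstD hYD))) _)) (mul_mem hXtD ha')
        · rw [pow_succ', mul_assoc, h', mul_add]
          ext j
          have e1 := congrFun hYtY j
          have e2 := congrFun hbtbt j
          have e3 := congrFun hXt j
          simp only [Pi.add_apply, Pi.mul_apply, Pi.smul_apply, smul_eq_mul, Pi.one_apply] at *
          push_cast
          linear_combination (Y j + κ * (st j * Y j)) * e3 + (1 + κ * st j) * e1 +
            κ * Y j * e2
    obtain ⟨a', ha', h'⟩ := key κ
    obtain ⟨m, hm, q', hq', hmq⟩ : ∃ m : ℤ, (m = 0 ∨ t + 1 = e ∨ Odd κ) ∧ ∃ q' ∈ highRing J t,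
        (κ : ℚ) • (st * Y) = (m : ℚ) • (st * Y) + (2 : ℚ) • q' := by
      rcases Nat.even_or_odd κ with ⟨l, hl⟩ | ho
      · refine ⟨0, Or.inl rfl, ((l : ℤ) : ℚ) • (st * Y),
          subring_smul_mem _ (mul_mem hstD hYD) _, ?_⟩
        rw [hl, smul_smul]
        push_cast
        rw [zero_smul, zero_add]
        congr 1
        ring
      · exact ⟨κ, Or.inr (Or.inr ho), 0, zero_mem _, by simp⟩
    refine ⟨m, hm, st, hst, 0, zero_mem _, a' + q' + (oddFun J ^ 2 ^ t) ^ κ *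
      ((s' + c) + (ε : ℚ) • (Y * (s' + c)) + a), ?_, ?_⟩
    · have hsc := add_mem hs' (baseRing_le J t hc)
      exact add_mem (add_mem ha' hq') (mul_mem (pow_mem hXtD κ) (add_mem (add_mem hsc
        (subring_smul_mem _ (mul_mem hYD hsc) _)) ha))
    · rw [hW, ← hYdef]
      ext j
      have e1 := congrFun h' j
      have e2 := congrFun hss' j
      have e3 := congrFun hmq j
      simp only [Pi.add_apply, Pi.mul_apply, Pi.smul_apply, smul_eq_mul, Pi.pow_apply,
        Pi.zero_apply] at *
      linear_combination (2 : ℚ) ^ d * e1 + (2 : ℚ) ^ d * e3 +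
        (2 : ℚ) ^ d * (oddFun J j ^ 2 ^ t) ^ κ * (1 + ε * Y j) * e2

/-- The expansion of `x ^ (p₀ + 2 ^ t * κ) * (x ^ 2 ^ (e - 1 + d) - 1)` for `x = oddFun J`, up to
elements on which `oddSum` is integral. -/
theorem oddFun_pow_add_mul_expansion {J e t p₀ : ℕ} (he : 2 ≤ e) (hte : t < e)
    (hJ : J ≤ 2 ^ (e - 1) + 2 ^ t) (hp₀ : p₀ < 2 ^ t) {κ : ℕ}
    (hκ : t + 1 = e ∨ Odd κ → ∀ r, 2 ^ t ≤ 2 * r → J ≤ 2 ^ (e - 1) + (p₀ + r)) (d : ℕ) :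
    ∃ v : ℤ, Odd v ∧ ∃ β ∈ baseRing J, ∃ a ∈ highRing J t,
      ((2 : ℚ) ^ alpha p₀) • (oddFun J ^ (p₀ + 2 ^ t * κ) * (oddFun J ^ 2 ^ (e - 1 + d) - 1)) =
        ((2 : ℚ) ^ d) • ((v / 2 : ℚ) • basisFun J (2 ^ (e - 1) + p₀) + β) +
          ((2 : ℚ) ^ (d + 1)) • a := by
  have hpow : 2 ^ t ≤ 2 ^ (e - 1) := Nat.pow_le_pow_right (by norm_num) (by omega)
  obtain ⟨u, hu, c, hc, σ, hσ, β, hβ, a, ha, h⟩ := oddFun_pow_mul_expansion he hte hJ κ d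
  obtain ⟨v, hv, a₀, ha₀, h₀⟩ := two_pow_alpha_smul_oddFun_pow J p₀
  obtain ⟨a₁, ha₁, h₁⟩ := basisFun_mul_eq J p₀ (2 ^ (e - 1))
  have hC := odd_choose_add_two_pow (a := p₀) (i := e - 1) (by omega)
  have hYD := half_smul_basisFun_mem (J := J) hpow u
  have hσD := baseRing_le J t (midLattice_le J t hσ)
  have ha₀D := baseRing_le J t ha₀
  have hpB := basisFun_mem J p₀
  have hpD := baseRing_le J t hpB
  have hkill : ∃ q ∈ highRing J t, (c : ℚ) • (basisFun J p₀ *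
      (σ * ((u / 2 : ℚ) • basisFun J (2 ^ (e - 1))))) = (2 : ℚ) • q := by
    rcases hc with rfl | hc
    · exact ⟨0, zero_mem _, by simp⟩
    have hmem : basisFun J p₀ * basisFun J (2 ^ (e - 1)) * σ ∈
        dilate 4 (baseRing J).toAddSubgroup := by
      refine mul_mem_of_closure (S₁ := {basisFun J p₀ * basisFun J (2 ^ (e - 1))}) ?_
        (AddSubgroup.subset_closure rfl) hσ
      rintro _ rfl _ ⟨r, ⟨hr, _⟩, rfl⟩
      obtain ⟨b₁, hb₁, e₁⟩ := basisFun_mul_eq J p₀ r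
      obtain ⟨b₂, hb₂, e₂⟩ := basisFun_mul_eq J (p₀ + r) (2 ^ (e - 1))
      rw [basisFun_eq_zero (r := p₀ + r + 2 ^ (e - 1))
        ((hκ hc r hr).trans_eq (add_comm _ _))] at e₂
      refine mem_dilate.2 ⟨((((p₀ + r).choose p₀ : ℕ) : ℤ) : ℚ) • b₂ +
        b₁ * basisFun J (2 ^ (e - 1)), (baseRing J).add_mem (subring_smul_mem _ hb₂ _)
          ((baseRing J).mul_mem hb₁ (basisFun_mem J _)), ?_⟩
      ext j
      have e3 := congrFun e₁ j
      have e4 := congrFun e₂ j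
      simp only [Pi.add_apply, Pi.mul_apply, Pi.smul_apply, smul_eq_mul, Pi.zero_apply] at *
      push_cast
      linear_combination basisFun J (2 ^ (e - 1)) j * e3 + ((p₀ + r).choose p₀ : ℚ) * e4
    obtain ⟨q, hq, e₁⟩ := mem_dilate.1 hmem
    refine ⟨((c * u : ℤ) : ℚ) • q, subring_smul_mem _ (baseRing_le J t hq) _, ?_⟩
    ext j
    have e3 := congrFun e₁ j
    simp only [Pi.mul_apply, Pi.smul_apply, smul_eq_mul] at *
    push_cast
    linear_combination (c * u / 2 : ℚ) * e3
  obtain ⟨q, hq, hkill⟩ := hkill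
  refine ⟨v * u * (p₀ + 2 ^ (e - 1)).choose p₀, (hv.mul hu).mul (by exact_mod_cast hC),
    (v : ℚ) • (basisFun J p₀ * β) + ((2 : ℤ) : ℚ) • (a₀ * β) + ((2 * (v * u) : ℤ) : ℚ) • a₁,
    ?_, (v : ℚ) • q + a₀ * ((u / 2 : ℚ) • basisFun J (2 ^ (e - 1)) + (c : ℚ) • (σ *
      ((u / 2 : ℚ) • basisFun J (2 ^ (e - 1))))) +
      ((v : ℚ) • basisFun J p₀ + ((2 : ℤ) : ℚ) • a₀) * a, ?_, ?_⟩
  · exact add_mem (add_mem (subring_smul_mem _ (mul_mem hpB hβ) _)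
      (subring_smul_mem _ (mul_mem ha₀ hβ) _)) (subring_smul_mem _ ha₁ _)
  · exact add_mem (add_mem (subring_smul_mem _ hq _) (mul_mem ha₀D (add_mem hYD
      (subring_smul_mem _ (mul_mem hσD hYD) _)))) (mul_mem (add_mem (subring_smul_mem _ hpD _)
      (subring_smul_mem _ ha₀D _)) ha)
  · rw [pow_add (oddFun J), mul_assoc, ← smul_mul_assoc, h₀, h, add_comm (2 ^ (e - 1)) p₀]
    ext j
    have e1 := congrFun h₁ j
    have e2 := congrFun hkill j
    simp only [Pi.add_apply, Pi.mul_apply, Pi.smul_apply, smul_eq_mul] at *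
    push_cast
    linear_combination (2 : ℚ) ^ d * (v * u / 2) * e1 + (2 : ℚ) ^ d * v * e2

/-! ### Parity of the normalized sums -/

theorem oddSum_highRing_pow {e t n : ℕ} (hte : t < e) (hn : 2 ^ e < n)
    (hn' : n < 2 ^ e + 2 ^ (t + 1)) {p₀ κ : ℕ} :
    ((2 : ℚ) ^ alpha p₀) • oddFun ((n + 1) / 2) ^ (p₀ + 2 ^ t * κ) ∈ highRing ((n + 1) / 2) t ∧
      ∃ z : ℤ, 2 * oddSum n (((2 : ℚ) ^ alpha p₀) • oddFun _ ^ (p₀ + 2 ^ t * κ)) = z := by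
  have hD : ((2 : ℚ) ^ alpha p₀) • oddFun ((n + 1) / 2) ^ (p₀ + 2 ^ t * κ) ∈
      highRing ((n + 1) / 2) t := by
    obtain ⟨v, hv, a₀, ha₀, h₀⟩ := two_pow_alpha_smul_oddFun_pow ((n + 1) / 2) p₀
    obtain ⟨u, hu, s, hs, c, hc, h⟩ := oddFun_pow_two_pow ((n + 1) / 2) t
    rw [pow_add, pow_mul, ← smul_mul_assoc, h₀, h]
    refine mul_mem (baseRing_le _ t (add_mem (subring_smul_mem _ (basisFun_mem _ _) _)
      (by simpa using subring_smul_mem _ ha₀ 2))) (pow_mem (add_mem (add_mem (one_mem _)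
        (half_smul_basisFun_mem le_rfl u)) (baseRing_le _ t (add_mem (midLattice_le _ _ hs)
          (by simpa using subring_smul_mem _ hc 2)))) _)
  exact ⟨hD, oddSum_highRing hte hn hn' hD⟩

theorem oddSum_midLattice_mul {n w r : ℕ} (hn : 0 < n) (hw : 2 ^ (w + 1) ∣ n)
    (hr : 2 ^ (w + 1) ∣ r) {s : Fin ((n + 1) / 2) → ℚ} (hs : s ∈ midLattice _ w) :
    ∃ z : ℤ, oddSum n (s * basisFun _ r) = 2 * z := by
  unfold midLattice at hs
  induction hs using AddSubgroup.closure_induction with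
  | mem f hf =>
    obtain ⟨q, ⟨hq, hq'⟩, rfl⟩ := hf
    obtain ⟨a, ha, h⟩ := basisFun_mul_eq ((n + 1) / 2) q r
    obtain ⟨z, hz⟩ := oddSum_baseRing hn ha
    have hmod : (q + r) % 2 ^ (w + 1) ≠ 0 := by
      rw [Nat.add_mod, Nat.mod_eq_zero_of_dvd hr, add_zero, Nat.mod_mod,
        Nat.mod_eq_of_lt (by rw [pow_succ]; omega)]
      have := Nat.two_pow_pos w
      omega
    obtain ⟨c, hc⟩ := two_dvd_choose_of_mod_ne_zero hn hw hmod
    refine ⟨(q + r).choose q * c + 2 * z, ?_⟩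
    rw [h, map_add, map_smul, map_smul, oddSum_basisFun hn, hz, hc, smul_eq_mul, smul_eq_mul]
    push_cast
    ring
  | zero => exact ⟨0, by simp⟩
  | add f g _ _ h1 h2 =>
    obtain ⟨a, ha⟩ := h1
    obtain ⟨b, hb⟩ := h2
    exact ⟨a + b, by rw [add_mul, map_add, ha, hb]; push_cast; ring⟩
  | neg f _ h1 =>
    obtain ⟨a, ha⟩ := h1
    exact ⟨-a, by rw [neg_mul, map_neg, ha]; push_cast; ring⟩

/-- Both parities needed for the exponents `k` and `2 ^ w + k` with `k = p % 2 ^ t + 2 ^ t * κ`. -/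
theorem oddSum_pow_parity {e t n p κ : ℕ} (he : 2 ≤ e) (hte : t < e) (hn : 2 ^ e + 2 ^ t ≤ n)
    (hn' : n < 2 ^ e + 2 ^ (t + 1)) (hp : Odd ((n - 1 - p).choose p))
    (hlast : t + 1 = e ∨ Odd κ → n - 1 - 2 ^ e < 2 ^ t + p % 2 ^ t) (d : ℕ) :
    (∃ z : ℤ, Odd z ∧ 2 ^ (alpha (p % 2 ^ t) + 1) * oddSum n
      (oddFun _ ^ (p % 2 ^ t + 2 ^ t * κ) * (oddFun _ ^ 2 ^ (e - 1 + d) - 1)) = 2 ^ d * z) ∧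
    ∀ w, w + 1 = padicValNat 2 n → w < t →
      ∃ z : ℤ, Odd z ∧ 2 ^ (alpha (p % 2 ^ t) + 1) * oddSum n
        (oddFun _ ^ (2 ^ w + (p % 2 ^ t + 2 ^ t * κ)) * (oddFun _ ^ 2 ^ (e - 1 + d) - 1)) =
          2 ^ d * z := by
  have hT := Nat.two_pow_pos t
  have hn0 : 0 < n := lt_of_lt_of_le (by positivity) hn
  have hne : 2 ^ e < n := by omega
  have he2 : 2 ^ e = 2 * 2 ^ (e - 1) := by rw [← pow_succ']; congr 1; omega
  have ht2 : 2 ^ (t + 1) = 2 * 2 ^ t := pow_succ' _ _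
  have hp₀ : p % 2 ^ t < 2 ^ t := Nat.mod_lt _ hT
  obtain ⟨v, hv, β, hβ, a, ha, h⟩ := oddFun_pow_add_mul_expansion (J := (n + 1) / 2) he hte
    (by omega) hp₀ (κ := κ) (fun hk r hr => by have := hlast hk; omega) d
  obtain ⟨C, hC⟩ := odd_choose_two_pow_add_mod hte hn hn' hp (fun h => hlast (Or.inl h))
  obtain ⟨zβ, hzβ⟩ := oddSum_baseRing hn0 hβ
  obtain ⟨za, hza⟩ := oddSum_highRing hte hne hn' ha
  set r := 2 ^ (e - 1) + p % 2 ^ t with hr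
  set H := oddFun ((n + 1) / 2) ^ (p % 2 ^ t + 2 ^ t * κ) *
    (oddFun ((n + 1) / 2) ^ 2 ^ (e - 1 + d) - 1) with hH
  have hHsum : 2 * oddSum n (((2 : ℚ) ^ alpha (p % 2 ^ t)) • H) =
      2 ^ d * ((v * (2 * C + 1) + 2 * zβ + 2 * za : ℤ) : ℚ) := by
    rw [h, map_add, map_smul, map_smul, map_add, map_smul, oddSum_basisFun hn0, hC, hzβ]
    simp only [smul_eq_mul]
    push_cast
    linear_combination (2 : ℚ) ^ (d + 1) * hza
  have hodd : Odd (v * (2 * C + 1) + 2 * zβ + 2 * za : ℤ) := by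
    have h1 : Odd (v * (2 * C + 1) : ℤ) := hv.mul (by simp)
    exact (h1.add_even (even_two_mul _)).add_even (even_two_mul _)
  refine ⟨⟨_, hodd, ?_⟩, ?_⟩
  · rw [← hHsum, map_smul, smul_eq_mul]
    ring
  · intro w hw hwt
    have hwn : 2 ^ (w + 1) ∣ n := hw ▸ pow_padicValNat_dvd
    have hwn' : ¬ 2 ^ (w + 2) ∣ n := by
      rw [padicValNat_dvd_iff_le hn0.ne', ← hw]
      omega
    have hwp : 2 ^ (w + 1) ∣ p := by
      by_contra hc
      have := two_dvd_choose_of_mod_ne_zero hn0 hwn (fun h0 => hc (Nat.dvd_of_mod_eq_zero h0))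
      rw [← even_iff_two_dvd] at this
      exact Nat.not_even_iff_odd.2 hp this
    have hwr : 2 ^ (w + 1) ∣ r :=
      dvd_add (pow_dvd_pow 2 (by omega)) ((Nat.dvd_mod_iff (pow_dvd_pow 2 (by omega))).2 hwp)
    obtain ⟨u, hu, s, hs, c, hc, hX⟩ := oddFun_pow_two_pow ((n + 1) / 2) w
    have hsB := midLattice_le _ _ hs
    have hcD := baseRing_le _ t hc
    have hrD := half_smul_basisFun_mem (J := (n + 1) / 2) (t := t) (r := r)
      ((Nat.pow_le_pow_right (by norm_num) (by omega : t ≤ e - 1)).trans (Nat.le_add_right _ _)) v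
    -- the contribution of `basisFun (2 ^ w)`
    obtain ⟨z₁, hz₁⟩ : ∃ z : ℤ, oddSum n (basisFun _ (2 ^ w) * basisFun _ r) = 4 * z := by
      obtain ⟨b, hb, hmul⟩ := basisFun_mul_eq ((n + 1) / 2) (2 ^ w) r
      obtain ⟨z, hz⟩ := oddSum_baseRing hn0 hb
      have hbit : (2 ^ w + r) % 2 ^ (w + 1) = 2 ^ w + (2 ^ w + r) % 2 ^ w := by
        obtain ⟨m, hm⟩ := hwr
        rw [hm, Nat.add_mul_mod_self_left, pow_succ, mul_assoc, Nat.add_mul_mod_self_left,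
          Nat.mod_self, Nat.mod_eq_of_lt (by have := Nat.two_pow_pos w; omega), add_zero]
      obtain ⟨q, hq⟩ := four_dvd_choose_of_bit hn0 hwn hwn' hbit
      refine ⟨(2 ^ w + r).choose (2 ^ w) * q + z, ?_⟩
      rw [hmul, map_add, map_smul, map_smul, oddSum_basisFun hn0, hz, hq]
      simp only [smul_eq_mul]
      push_cast
      ring
    obtain ⟨z₂, hz₂⟩ := oddSum_basisFun_mul_baseRing hn0 hwn hβ
    obtain ⟨z₃, hz₃⟩ := oddSum_basisFun_mul_highRing hte hne hn' hwt hwn ha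
    -- the contribution of the error term
    obtain ⟨z₄, hz₄⟩ := oddSum_midLattice_mul hn0 hwn hwr hs
    obtain ⟨z₅, hz₅⟩ := oddSum_baseRing hn0 ((baseRing _).mul_mem hsB hβ)
    obtain ⟨z₆, hz₆⟩ := oddSum_highRing hte hne hn' (mul_mem (baseRing_le _ t hsB) ha)
    obtain ⟨z₇, hz₇⟩ := oddSum_highRing hte hne hn' (mul_mem hcD (add_mem (add_mem hrD
      (baseRing_le _ t hβ)) (subring_smul_mem _ ha 2)))
    have e₁ : oddSum n (basisFun _ (2 ^ w) * (((2 : ℚ) ^ alpha (p % 2 ^ t)) • H)) =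
        2 ^ d * (2 * (v * z₁ + z₂ + z₃ : ℤ)) := by
      have : basisFun _ (2 ^ w) * (((2 : ℚ) ^ alpha (p % 2 ^ t)) • H) =
          ((2 : ℚ) ^ d * (v / 2)) • (basisFun _ (2 ^ w) * basisFun _ r) +
            ((2 : ℚ) ^ d) • (basisFun _ (2 ^ w) * β) +
            ((2 : ℚ) ^ (d + 1)) • (a * basisFun _ (2 ^ w)) := by
        rw [h]
        ext j
        simp only [Pi.add_apply, Pi.mul_apply, Pi.smul_apply, smul_eq_mul]
        ring
      rw [this, map_add, map_add, map_smul, map_smul, map_smul, hz₁, hz₂, hz₃]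
      simp only [smul_eq_mul]
      push_cast
      ring
    have e₂ : 2 * oddSum n ((s + (2 : ℚ) • c) * (((2 : ℚ) ^ alpha (p % 2 ^ t)) • H)) =
        2 ^ d * (2 * (v * z₄ + z₅ + z₆ + z₇ : ℤ)) := by
      have : (s + (2 : ℚ) • c) * (((2 : ℚ) ^ alpha (p % 2 ^ t)) • H) =
          ((2 : ℚ) ^ d * (v / 2)) • (s * basisFun _ r) + ((2 : ℚ) ^ d) • (s * β) +
            ((2 : ℚ) ^ (d + 1)) • (s * a) + ((2 : ℚ) ^ (d + 1)) •
              (c * ((v / 2 : ℚ) • basisFun _ r + β + ((2 : ℤ) : ℚ) • a)) := by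
        rw [h]
        ext j
        simp only [Pi.add_apply, Pi.mul_apply, Pi.smul_apply, smul_eq_mul]
        push_cast
        ring
      rw [this, map_add, map_add, map_add, map_smul, map_smul, map_smul, map_smul, hz₄, hz₅]
      simp only [smul_eq_mul]
      push_cast
      linear_combination (2 : ℚ) ^ (d + 1) * hz₆ + (2 : ℚ) ^ (d + 1) * hz₇
    have e₃ : ((2 : ℚ) ^ alpha (p % 2 ^ t)) • (oddFun ((n + 1) / 2) ^
        (2 ^ w + (p % 2 ^ t + 2 ^ t * κ)) * (oddFun ((n + 1) / 2) ^ 2 ^ (e - 1 + d) - 1)) =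
        ((2 : ℚ) ^ alpha (p % 2 ^ t)) • H + (u / 2 : ℚ) • (basisFun _ (2 ^ w) *
          (((2 : ℚ) ^ alpha (p % 2 ^ t)) • H)) +
            (s + (2 : ℚ) • c) * (((2 : ℚ) ^ alpha (p % 2 ^ t)) • H) := by
      rw [pow_add (oddFun _) (2 ^ w), mul_assoc, ← hH, hX]
      ext j
      simp only [Pi.add_apply, Pi.mul_apply, Pi.smul_apply, smul_eq_mul, Pi.one_apply]
      ring
    refine ⟨v * (2 * C + 1) + 2 * zβ + 2 * za + 2 * (u * (v * z₁ + z₂ + z₃)) +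
      2 * (v * z₄ + z₅ + z₆ + z₇), (hodd.add_even (even_two_mul _)).add_even (even_two_mul _), ?_⟩
    have e₄ := congrArg (fun f => 2 * oddSum n f) e₃
    simp only [map_add] at e₄
    rw [map_smul _ (u / 2 : ℚ), e₁, smul_eq_mul, mul_add, mul_add, hHsum, e₂, map_smul,
      smul_eq_mul] at e₄
    rw [pow_succ', mul_assoc, e₄]
    push_cast
    ring

theorem oddSum_pow_integral {e t n κ p₀ w : ℕ} (hte : t < e) (hne : 2 ^ e < n)
    (hn' : n < 2 ^ e + 2 ^ (t + 1)) (hw : 2 ^ (w + 1) ∣ n) (hwt : w < t) :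
    ∃ z : ℤ, 2 ^ (alpha p₀ + 1) * oddSum n (oddFun _ ^ (2 ^ w + (p₀ + 2 ^ t * κ))) = z := by
  obtain ⟨hD, z, hz⟩ := oddSum_highRing_pow hte hne hn' (p₀ := p₀) (κ := κ)
  obtain ⟨u, hu, s, hs, c, hc, hX⟩ := oddFun_pow_two_pow ((n + 1) / 2) w
  obtain ⟨z₁, hz₁⟩ := oddSum_basisFun_mul_highRing hte hne hn' hwt hw hD
  obtain ⟨z₂, hz₂⟩ := oddSum_highRing hte hne hn' (mul_mem (baseRing_le _ t
    (add_mem (midLattice_le _ _ hs) (subring_smul_mem _ hc 2))) hD)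
  refine ⟨z + u * z₁ + z₂, ?_⟩
  have e₁ : ((2 : ℚ) ^ alpha p₀) • oddFun ((n + 1) / 2) ^ (2 ^ w + (p₀ + 2 ^ t * κ)) =
      ((2 : ℚ) ^ alpha p₀) • oddFun ((n + 1) / 2) ^ (p₀ + 2 ^ t * κ) +
      (u / 2 : ℚ) • (((2 : ℚ) ^ alpha p₀) • oddFun ((n + 1) / 2) ^ (p₀ + 2 ^ t * κ) *
        basisFun _ (2 ^ w)) +
      (s + ((2 : ℤ) : ℚ) • c) * (((2 : ℚ) ^ alpha p₀) •
        oddFun ((n + 1) / 2) ^ (p₀ + 2 ^ t * κ)) := by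
    rw [pow_add (oddFun _) (2 ^ w), hX]
    ext j
    simp only [Pi.add_apply, Pi.mul_apply, Pi.smul_apply, smul_eq_mul, Pi.one_apply]
    push_cast
    ring
  have e₂ := congrArg (fun f => 2 * oddSum n f) e₁
  simp only [map_add] at e₂
  rw [map_smul _ (u / 2 : ℚ), hz₁, smul_eq_mul, mul_add, mul_add, hz, hz₂, map_smul,
    smul_eq_mul] at e₂
  rw [pow_succ', mul_assoc, e₂]
  push_cast
  ring

open Filter Topology

/-! ### 2-adic zeros -/

theorem norm_intCast_of_odd {z : ℤ} (hz : Odd z) : ‖(z : ℤ_[2])‖ = 1 := by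
  by_contra h
  have h1 : ‖(z : ℤ_[2])‖ < 1 := lt_of_le_of_ne (PadicInt.norm_le_one _) h
  rw [PadicInt.norm_int_lt_one_iff_dvd] at h1
  exact (Int.not_even_iff_odd.2 hz) (even_iff_two_dvd.2 (by exact_mod_cast h1))

theorem norm_sub_eq_of_step {g : ℕ → ℤ}
    (hg : ∀ x d : ℕ, ∃ z : ℤ, Odd z ∧ g (x + 2 ^ d) - g x = 2 ^ d * z) (x y : ℕ) :
    ‖(g x : ℤ_[2]) - g y‖ = ‖(x : ℤ_[2]) - y‖ := by
  wlog hxy : x ≤ y generalizing x y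
  · rw [norm_sub_rev, this y x (by omega), norm_sub_rev]
  have hmul : ∀ d m : ℕ, ∃ z : ℤ, g (x + 2 ^ d * m) - g x = 2 ^ d * (m + 2 * z) := by
    intro d m
    induction m with
    | zero => exact ⟨0, by simp⟩
    | succ m ih =>
      obtain ⟨z, hz⟩ := ih
      obtain ⟨y, ⟨k, rfl⟩, hy⟩ := hg (x + 2 ^ d * m) d
      refine ⟨z + k, ?_⟩
      rw [mul_add, mul_one, ← add_assoc]
      push_cast
      linear_combination hz + hy
  obtain ⟨m, rfl⟩ := Nat.exists_eq_add_of_le hxy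
  rcases Nat.eq_zero_or_pos m with rfl | hm
  · simp
  obtain ⟨d, k, hk, rfl⟩ := Nat.exists_eq_two_pow_mul_odd hm.ne'
  obtain ⟨z, hz⟩ := hmul d k
  have hz' := congrArg (Int.cast : ℤ → ℤ_[2]) hz
  have hodd : Odd ((k : ℤ) + 2 * z) := Odd.add_even (by exact_mod_cast hk) (even_two_mul z)
  have h1 := norm_intCast_of_odd hodd
  have h2 := norm_intCast_of_odd (z := (k : ℤ)) (by exact_mod_cast hk)
  push_cast at hz' h1 h2 ⊢
  rw [norm_sub_rev, hz', norm_mul, h1, norm_sub_rev, add_sub_cancel_left, norm_mul, h2]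

theorem exists_zero_of_step {g : ℕ → ℤ}
    (hg : ∀ x d : ℕ, ∃ z : ℤ, Odd z ∧ g (x + 2 ^ d) - g x = 2 ^ d * z) :
    ∃ x₀ : ℤ_[2], ∀ x : ℕ, ‖(g x : ℤ_[2])‖ = ‖(x : ℤ_[2]) - x₀‖ := by
  have hdvd : ∀ d : ℕ, ∃ a : ℕ, (2 : ℤ) ^ d ∣ g a := by
    intro d
    induction d with
    | zero => exact ⟨0, by simp⟩
    | succ d ih =>
      obtain ⟨a, c, hc⟩ := ih
      rcases Int.even_or_odd' c with ⟨b, rfl | rfl⟩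
      · exact ⟨a, b, by rw [hc]; ring⟩
      · obtain ⟨z, ⟨k, rfl⟩, hz⟩ := hg a d
        exact ⟨a + 2 ^ d, b + k + 1, by linear_combination hz + hc⟩
  choose a ha using hdvd
  have hlim : Tendsto (fun d => (g (a d) : ℤ_[2])) atTop (𝓝 0) := by
    rw [tendsto_zero_iff_norm_tendsto_zero]
    refine squeeze_zero (fun _ => norm_nonneg _) (fun d => ?_)
      (tendsto_pow_atTop_nhds_zero_of_lt_one (r := (2⁻¹ : ℝ)) (by norm_num) (by norm_num))
    obtain ⟨c, hc⟩ := ha d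
    rw [hc]
    push_cast
    rw [norm_mul, norm_pow]
    have h2 : ‖(2 : ℤ_[2])‖ = 2⁻¹ := by simpa using PadicInt.norm_p (p := 2)
    rw [h2]
    exact mul_le_of_le_one_right (by positivity) (PadicInt.norm_le_one _)
  have hcauchy : CauchySeq fun d => (a d : ℤ_[2]) := by
    have h1 := hlim.cauchySeq
    rw [Metric.cauchySeq_iff] at h1 ⊢
    intro ε hε
    obtain ⟨N, hN⟩ := h1 ε hε
    refine ⟨N, fun m hm k hk => ?_⟩
    have := hN m hm k hk
    rwa [dist_eq_norm, norm_sub_eq_of_step hg, ← dist_eq_norm] at this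
  obtain ⟨x₀, hx₀⟩ := cauchySeq_tendsto_of_complete hcauchy
  refine ⟨x₀, fun x => ?_⟩
  have h1 : Tendsto (fun d => ‖(g x : ℤ_[2]) - g (a d)‖) atTop (𝓝 ‖(g x : ℤ_[2]) - 0‖) :=
    (tendsto_const_nhds.sub hlim).norm
  have h2 : Tendsto (fun d => ‖(x : ℤ_[2]) - a d‖) atTop (𝓝 ‖(x : ℤ_[2]) - x₀‖) :=
    (tendsto_const_nhds.sub hx₀).norm
  simp only [norm_sub_eq_of_step hg, sub_zero] at h1
  exact tendsto_nhds_unique h1 h2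

theorem odd_pow_two_pow {u : ℤ} (hu : Odd u) (N : ℕ) : ∃ y : ℤ, u ^ 2 ^ N = 1 + 2 ^ (N + 1) * y := by
  induction N with
  | zero =>
    obtain ⟨k, rfl⟩ := hu
    exact ⟨k, by ring⟩
  | succ N ih =>
    obtain ⟨y, hy⟩ := ih
    exact ⟨y + 2 ^ N * y ^ 2, by rw [pow_succ, pow_mul, hy]; ring⟩

theorem tendsto_two_pow : Tendsto (fun N : ℕ => (2 : ℚ_[2]) ^ N) atTop (𝓝 0) := by
  apply tendsto_pow_atTop_nhds_zero_of_norm_lt_one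
  have : ‖(2 : ℚ_[2])‖ = 2⁻¹ := by simpa using Padic.norm_p (p := 2)
  rw [this]
  norm_num

theorem tendsto_odd_pow {u : ℤ} (hu : Odd u) :
    Tendsto (fun N : ℕ => (u : ℚ_[2]) ^ 2 ^ N) atTop (𝓝 1) := by
  rw [tendsto_iff_norm_sub_tendsto_zero]
  have h0 := tendsto_two_pow.norm
  rw [norm_zero] at h0
  refine squeeze_zero (fun _ => norm_nonneg _) (fun N => ?_) h0
  obtain ⟨y, hy⟩ := odd_pow_two_pow hu N
  have hy' := congrArg (Int.cast : ℤ → ℚ_[2]) hy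
  have h1 := Padic.norm_int_le_one (p := 2) (2 * y)
  push_cast at hy' h1
  rw [hy', add_sub_cancel_left, pow_succ, mul_assoc, norm_mul]
  exact mul_le_of_le_one_right (by positivity) h1

theorem tendsto_T (n c q : ℕ) (x : ℤ) :
    Tendsto (fun N : ℕ => ((T n (c * (x + 2 ^ N) + q) : ℚ) : ℚ_[2])) atTop
      (𝓝 ((T n (c * x + q) : ℚ) : ℚ_[2])) := by
  simp only [T_eq_sum, Rat.cast_sum, Rat.cast_mul, Rat.cast_zpow, Rat.cast_natCast]
  refine tendsto_finsetSum _ fun j _ => tendsto_const_nhds.mul ?_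
  have hodd : Odd (((2 * (j : ℕ) + 1 : ℕ) : ℤ) ^ c) :=
    Odd.pow (by push_cast; exact odd_two_mul_add_one _)
  have h := (tendsto_odd_pow hodd).const_mul
    (((2 * (j : ℕ) + 1 : ℕ) : ℚ_[2]) ^ ((c : ℤ) * x + q))
  rw [mul_one] at h
  refine h.congr fun N => ?_
  have h0 : ((2 * (j : ℕ) + 1 : ℕ) : ℚ_[2]) ≠ 0 := Nat.cast_ne_zero.2 (by omega)
  have e1 : (c : ℤ) * (x + 2 ^ N) + q = ((c : ℤ) * x + q) + ((c * 2 ^ N : ℕ) : ℤ) := by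
    push_cast
    ring
  rw [e1, zpow_add₀ h0 (_ + _) ((c * 2 ^ N : ℕ) : ℤ), zpow_natCast _ (c * 2 ^ N), pow_mul]
  push_cast
  rfl

theorem nu_eq_of_norm_eq {a b : ℚ_[2]} (h : ‖a‖ = ‖b‖) : nu a = nu b := by
  unfold nu
  rcases eq_or_ne a 0 with rfl | ha
  · rw [norm_zero, eq_comm, norm_eq_zero] at h
    rw [h]
  · have hb : b ≠ 0 := by
      rintro rfl
      exact ha (by simpa using h)
    rw [Padic.addValuation.apply ha, Padic.addValuation.apply hb]
    rw [Padic.norm_eq_zpow_neg_valuation ha, Padic.norm_eq_zpow_neg_valuation hb] at h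
    have := zpow_right_injective₀ (by norm_num) (by norm_num) h
    rw [neg_inj.1 this]

theorem nu_two_zpow (c : ℤ) : nu ((2 : ℚ_[2]) ^ c) = (c : WithTop ℤ) := by
  unfold nu
  rw [Padic.addValuation.apply (zpow_ne_zero _ two_ne_zero), Padic.valuation_zpow]
  have : (2 : ℚ_[2]).valuation = 1 := by simp
  rw [this, mul_one]

/-- If the values `T n (2 ^ m * x + q)` at natural `x` are `2 ^ c` times integers whose increments
have the exact power of `2`, then they are governed by a 2-adic zero. -/
theorem exists_zero_of_T {n m q : ℕ} {c : ℤ} {g : ℕ → ℤ}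
    (hT : ∀ x : ℕ, T n ((2 ^ m * x + q : ℕ) : ℤ) = 2 ^ c * g x)
    (hg : ∀ x d : ℕ, ∃ z : ℤ, Odd z ∧ g (x + 2 ^ d) - g x = 2 ^ d * z) :
    ∃ x₀ : ℤ_[2], ∀ x : ℤ, nu ((T n (2 ^ m * x + (q : ℤ)) : ℚ) : ℚ_[2]) =
      nu ((x : ℚ_[2]) - (x₀ : ℚ_[2])) + (c : WithTop ℤ) := by
  obtain ⟨x₀, hx₀⟩ := exists_zero_of_step hg
  refine ⟨x₀, fun x => ?_⟩
  have hnat : ∀ x : ℕ, ‖((T n (2 ^ m * x + (q : ℤ)) : ℚ) : ℚ_[2])‖ =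
      ‖((x : ℚ_[2]) - (x₀ : ℚ_[2])) * 2 ^ c‖ := by
    intro x
    have h1 := hT x
    push_cast at h1
    rw [h1]
    have h2 := hx₀ x
    rw [PadicInt.norm_def, PadicInt.norm_def] at h2
    push_cast at h2 ⊢
    rw [norm_mul, norm_mul, h2, mul_comm]
  have hlim : Tendsto (fun N : ℕ => ((x : ℚ_[2]) + 2 ^ N - (x₀ : ℚ_[2])) * 2 ^ c) atTop
      (𝓝 (((x : ℚ_[2]) - (x₀ : ℚ_[2])) * 2 ^ c)) := by
    have := (((tendsto_two_pow.const_add (x : ℚ_[2])).sub_const (x₀ : ℚ_[2])).mul_const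
      ((2 : ℚ_[2]) ^ c))
    rwa [add_zero] at this
  have hT' := tendsto_T n (2 ^ m) q x
  have heq : ‖((T n (2 ^ m * x + (q : ℤ)) : ℚ) : ℚ_[2])‖ =
      ‖((x : ℚ_[2]) - (x₀ : ℚ_[2])) * 2 ^ c‖ := by
    push_cast at hT'
    refine tendsto_nhds_unique hT'.norm (hlim.norm.congr' ?_)
    filter_upwards [eventually_ge_atTop x.natAbs] with N hN
    have h1 : (0 : ℤ) ≤ x + 2 ^ N := by
      have h2 : N < 2 ^ N := Nat.lt_two_pow_self
      have h3 : (N : ℤ) < 2 ^ N := by exact_mod_cast h2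
      omega
    obtain ⟨y, hy⟩ := Int.eq_ofNat_of_zero_le h1
    have h2 := hnat y
    have h3 : ((x : ℚ_[2]) + 2 ^ N) = (y : ℚ_[2]) := by exact_mod_cast congrArg (Int.cast : ℤ → ℚ_[2]) hy
    rw [hy, h3, h2]
  rw [nu_eq_of_norm_eq heq, ← nu_two_zpow]
  exact AddValuation.map_mul _ _ _

/-- Multiplying `T` by the right power of `2` gives integers whose increments have the exact power
of `2`, from the two parity statements about `oddSum`. -/
theorem exists_zero_of_oddSum {n m q A : ℕ} (hn : 0 < n)
    (hint : ∀ x : ℕ, ∃ z : ℤ, 2 ^ (A + 1) * oddSum n (oddFun _ ^ (2 ^ m * x + q)) = z)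
    (hstep : ∀ x d : ℕ, ∃ z : ℤ, Odd z ∧ 2 ^ (A + 1) * oddSum n
      (oddFun _ ^ (2 ^ m * x + q) * (oddFun _ ^ 2 ^ (m + d) - 1)) = 2 ^ d * z) :
    ∃ x₀ : ℤ_[2], ∀ x : ℤ, nu ((T n (2 ^ m * x + (q : ℤ)) : ℚ) : ℚ_[2]) =
      nu ((x : ℚ_[2]) - (x₀ : ℚ_[2])) + (((n : ℤ) - 2 - (A : ℤ) : ℤ) : WithTop ℤ) := by
  choose g hg using hint
  refine exists_zero_of_T (g := g) (fun x => ?_) (fun x d => ?_)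
  · rw [T_natCast, ← hg x, ← mul_assoc]
    congr 1
    rw [← zpow_natCast, ← zpow_natCast, ← zpow_add₀ two_ne_zero]
    congr 1
    push_cast [Nat.cast_sub hn]
    ring
  · obtain ⟨z, hz, h⟩ := hstep x d
    refine ⟨z, hz, ?_⟩
    have e1 : (oddFun ((n + 1) / 2)) ^ (2 ^ m * (x + 2 ^ d) + q) = oddFun _ ^ (2 ^ m * x + q) +
        oddFun _ ^ (2 ^ m * x + q) * (oddFun _ ^ 2 ^ (m + d) - 1) := by
      rw [mul_sub, mul_one, add_sub_cancel, ← pow_add]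
      congr 1
      ring
    have h1 := hg (x + 2 ^ d)
    rw [e1, map_add, mul_add, hg, h] at h1
    have h2 : ((g (x + 2 ^ d) - g x : ℤ) : ℚ) = ((2 ^ d * z : ℤ) : ℚ) := by
      push_cast
      linarith
    exact_mod_cast h2

theorem lt_of_succ_eq_padicValNat {e t n w : ℕ} (hte : t < e) (hn : 2 ^ e + 2 ^ t ≤ n)
    (hn' : n < 2 ^ e + 2 ^ (t + 1)) (hw : w + 1 = padicValNat 2 n) : w < t := by
  have hT := Nat.two_pow_pos t
  have hdvd : 2 ^ (w + 1) ∣ n := hw ▸ pow_padicValNat_dvd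
  by_contra hc
  have h1 : 2 ^ (t + 1) ∣ n := (pow_dvd_pow 2 (by omega)).trans hdvd
  have h2 : 2 ^ (t + 1) ∣ n - 2 ^ e := Nat.dvd_sub h1 (pow_dvd_pow 2 hte)
  have := Nat.le_of_dvd (by omega) h2
  omega

theorem sub_lt_of_mem_S {e t n p : ℕ} (hte : t < e) (hn : 2 ^ e + 2 ^ t ≤ n)
    (hn' : n < 2 ^ e + 2 ^ (t + 1)) (hp : p ∈ S e n) {k : ℕ}
    (hk : t + 1 < e → k ≡ p [MOD 2 ^ (t + 1)]) :
    t + 1 = e ∨ Odd (k / 2 ^ t) → n - 1 - 2 ^ e < 2 ^ t + p % 2 ^ t := by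
  obtain ⟨hmax, hlt, hodd⟩ := hp
  have hT := Nat.two_pow_pos t
  rcases Nat.eq_or_lt_of_le (Nat.succ_le_of_lt hte) with h | h
  · intro _
    have he1 : e - 1 = t := by omega
    rw [he1] at hlt hmax
    rw [Nat.mod_eq_of_lt hlt]
    have h1 := (le_max_right _ _).trans hmax
    have h2 : n ≤ p + 2 ^ e + 2 ^ t := by
      zify
      linarith
    omega
  · rintro (h' | ho)
    · omega
    refine sub_lt_of_bit hte hn hn' hodd ?_
    have h1 : k % 2 ^ (t + 1) = p % 2 ^ (t + 1) := hk h
    have h2 : k % 2 ^ t = p % 2 ^ t :=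
      (hk h).of_dvd (pow_dvd_pow 2 (Nat.le_succ t))
    rw [← h1, ← h2, Nat.mod_pow_succ, Nat.odd_iff.1 ho]
    ring

end PartialStirling

theorem theorem1p4 (e t n : ℕ) (he : 2 ≤ e) (ht : t ≤ e - 1)
    (hn : 2 ^ e + 2 ^ t ≤ n) (hn' : n < 2 ^ e + 2 ^ (t + 1))
    (p q : ℕ) (hp : p ∈ PartialStirling.S e n)
    (hq : PartialStirling.Associated e t n q p) :
    ∃ x₀ : ℤ_[2], ∀ x : ℤ,
      PartialStirling.nu ((PartialStirling.T n (2 ^ (e - 1) * x + (q : ℤ)) : ℚ) : ℚ_[2]) =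
        PartialStirling.nu ((x : ℚ_[2]) - (x₀ : ℚ_[2])) +
          (((n : ℤ) - 2 - (PartialStirling.alpha (p % 2 ^ t) : ℤ) : ℤ) : WithTop ℤ) := by
  have hte : t < e := by omega
  have hne : 2 ^ e < n := lt_of_lt_of_le (Nat.lt_add_of_pos_right (by positivity)) hn
  have hn0 : 0 < n := Nat.zero_lt_of_lt hne
  have hodd := hp.2.2
  have key : ∀ k, k ≡ p [MOD 2 ^ t] → (t + 1 < e → k ≡ p [MOD 2 ^ (t + 1)]) →
      k = p % 2 ^ t + 2 ^ t * (k / 2 ^ t) ∧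
        (t + 1 = e ∨ Odd (k / 2 ^ t) → n - 1 - 2 ^ e < 2 ^ t + p % 2 ^ t) := fun k h1 h2 => by
    refine ⟨?_, PartialStirling.sub_lt_of_mem_S hte hn hn' hp h2⟩
    rw [← (h1 : k % 2 ^ t = p % 2 ^ t)]
    exact (Nat.mod_add_div _ _).symm
  have hmul : ∀ (i x : ℕ), i ≤ e - 1 → 2 ^ (e - 1) * x ≡ 0 [MOD 2 ^ i] := fun i x hi =>
    Nat.modEq_zero_iff_dvd.2 ((pow_dvd_pow 2 hi).mul_right x)
  have hp' : ∀ i x, i ≤ e - 1 → 2 ^ (e - 1) * x + p ≡ p [MOD 2 ^ i] := fun i x hi => by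
    simpa using (hmul i x hi).add_right p
  have main : (∀ x, 2 ^ (e - 1) * x + q ≡ p [MOD 2 ^ t]) →
      (t + 1 < e → ∀ x, 2 ^ (e - 1) * x + q ≡ p [MOD 2 ^ (t + 1)]) →
      ∃ x₀ : ℤ_[2], ∀ x : ℤ,
      PartialStirling.nu ((PartialStirling.T n (2 ^ (e - 1) * x + (q : ℤ)) : ℚ) : ℚ_[2]) =
        PartialStirling.nu ((x : ℚ_[2]) - (x₀ : ℚ_[2])) +
          (((n : ℤ) - 2 - (PartialStirling.alpha (p % 2 ^ t) : ℤ) : ℤ) : WithTop ℤ) := by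
    intro h1 h2
    refine PartialStirling.exists_zero_of_oddSum hn0 (fun x => ?_) (fun x d => ?_)
    · obtain ⟨hk, -⟩ := key _ (h1 x) (fun h => h2 h x)
      obtain ⟨-, z, hz⟩ := PartialStirling.oddSum_highRing_pow hte hne hn' (p₀ := p % 2 ^ t)
        (κ := (2 ^ (e - 1) * x + q) / 2 ^ t)
      rw [hk]
      exact ⟨z, by rw [← hz, map_smul, smul_eq_mul, pow_succ', mul_assoc]⟩
    · obtain ⟨hk, hκ⟩ := key _ (h1 x) (fun h => h2 h x)
      rw [hk]
      exact (PartialStirling.oddSum_pow_parity he hte hn hn' hodd hκ d).1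
  obtain ⟨hqe, rfl | ⟨w, hw | hw, rfl⟩⟩ := hq
  · exact main (fun x => hp' t x ht) (fun h x => hp' (t + 1) x (by omega))
  · have hwt := PartialStirling.lt_of_succ_eq_padicValNat hte hn hn' hw
    refine PartialStirling.exists_zero_of_oddSum hn0 (fun x => ?_) (fun x d => ?_)
    all_goals
      obtain ⟨hk, hκ⟩ := key _ (hp' t x ht) (fun h => hp' (t + 1) x (by omega))
      rw [show 2 ^ (e - 1) * x + (p + 2 ^ w) = 2 ^ w + (2 ^ (e - 1) * x + p) by ring, hk]
    · exact PartialStirling.oddSum_pow_integral hte hne hn' (hw ▸ pow_padicValNat_dvd) hwt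
    · exact (PartialStirling.oddSum_pow_parity he hte hn hn' hodd hκ d).2 w hw hwt
  · have hwe : w < e - 1 := (Nat.pow_lt_pow_iff_right (a := 2) (by norm_num)).1 (by omega)
    have hq' : ∀ i x, i ≤ t + 1 → 2 ^ (e - 1) * x + (p + 2 ^ w) ≡ p [MOD 2 ^ i] := fun i x hi => by
      rw [← add_assoc]
      simpa using (hp' i x (by omega)).add
        (Nat.modEq_zero_iff_dvd.2 (pow_dvd_pow 2 (by omega : i ≤ w)))
    exact main (fun x => hq' t x (Nat.le_succ t)) (fun _ x => hq' (t + 1) x le_rfl)
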